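/- Let $k\ge 1$ be a fixed integer. For each $n$, let $\pi$ be a uniformly random ordering of the $\binom n2$ pairs of vertices of $V=[n]$, and let $\tilde G=\{G_t\}_{t=0}^{\binom n2}$ be the random graph process in which $G_t$ is the graph on $V$ whose edges are the first $t$ pairs in the ordering $\pi$. For a graph property $\mathcal P$ put $\tau(\tilde G;\mathcal P)=\min\{t : G_t\in\mathcal P\}$. Let $\delta_{2k}$ be the property of having minimum degree at least $2k$. Let $\mathcal M_k$ be the property of all graphs $G$ for which Maker wins the following $k$-vertex-connectivity game on $G$: Breaker and Maker, with Breaker moving first, alternately claim one previously unclaimed edge of $G$ until all edges are claimed, and Maker wins if the graph on $V(G)$ formed by the edges he claimed is $k$-vertex-connected (it has more than $k$ vertices and remains connected after the removal of any fewer than $k$ vertices); that is, $G\in\mathcal M_k$ if and only if Maker has a strategy that wins against every strategy of Breaker. Then, with probability tending to $1$ as $n\to\infty$, both hitting times exist and $$\tau(\tilde G;\mathcal M_k)=\tau(\tilde G;\delta_{2k}).$$ -/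

import Mathlib

open Filter Topology

/-! ### Maker-Breaker games -/

namespace MakerBreaker

/-- A strategy of Maker on the finite board `X`: it sees the list `h` of all moves made so far by
both players (most recent move first) and, as long as some element of `X` is unclaimed, names an
unclaimed element of `X`. -/
def MakerStrategy {α : Type*} (X : Finset α) : Type _ :=
  (h : List α) → (∃ x ∈ X, x ∉ h) → {x : α // x ∈ X ∧ x ∉ h}

/-- The (partial) plays on the board `X` in which Maker follows the strategy `σ` and Breaker plays
arbitrarily. A play is the list of moves, most recent first. Breaker starts, so he is to move when
the number of moves made so far is even, and Maker is to move when it is odd. -/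
inductive Follows {α : Type*} {X : Finset α} (σ : MakerStrategy X) : List α → Prop
  | start : Follows σ []
  | breaker {h : List α} {b : α} :
      Follows σ h → Even h.length → b ∈ X → b ∉ h → Follows σ (b :: h)
  | maker {h : List α} (free : ∃ x ∈ X, x ∉ h) :
      Follows σ h → Odd h.length → Follows σ ((σ h free : α) :: h)

/-- The elements claimed by Maker in a play (most recent move first): the moves made after an odd
number of earlier moves. -/
def makerMoves {α : Type*} : List α → List α
  | [] => []
  | x :: h => if Odd h.length then x :: makerMoves h else makerMoves h

/-- The positional game with board `X` and family of winning sets `F`, Breaker moving first, is a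
Maker's win: Maker has a strategy such that, in every complete play in which he follows it, he has
claimed all elements of some winning set. -/
def IsMakerWin {α : Type*} (X : Finset α) (F : Set (Finset α)) : Prop :=
  ∃ σ : MakerStrategy X, ∀ h : List α, Follows σ h → (∀ x ∈ X, x ∈ h) →
    ∃ W ∈ F, ∀ x ∈ W, x ∈ makerMoves h

/-- The winning sets of the game on the edges of `G` for the graph property `P`: the sets of edges
of `G` which form a (spanning) graph with property `P`. -/
def winningEdgeSets {V : Type*} (P : SimpleGraph V → Prop) (G : SimpleGraph V) :
    Set (Finset (Sym2 V)) :=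
  {W | (W : Set (Sym2 V)) ⊆ G.edgeSet ∧ P (SimpleGraph.fromEdgeSet (W : Set (Sym2 V)))}

open Classical in
/-- The graph property that the Maker-Breaker game on the edge set of `G`, in which Maker wants his
graph to have property `P`, is a Maker's win. -/
noncomputable def MakerWinsGame {V : Type*} [Fintype V] (P : SimpleGraph V → Prop)
    (G : SimpleGraph V) : Prop :=
  IsMakerWin G.edgeFinset (winningEdgeSets P G)

end MakerBreaker

/-! ### Graph properties -/

/-- `G` is `k`-vertex-connected: it has more than `k` vertices and the removal of fewer than `k`
vertices always leaves a connected graph. -/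
def IsVertexConnected {V : Type*} [Fintype V] (k : ℕ) (G : SimpleGraph V) : Prop :=
  k < Fintype.card V ∧
    ∀ S : Finset V, S.card < k → (G.induce ((S : Set V)ᶜ)).Connected

open Classical in
/-- `G` has minimum degree at least `d`. -/
def HasMinDegreeAtLeast {V : Type*} [Fintype V] (d : ℕ) (G : SimpleGraph V) : Prop :=
  d ≤ G.minDegree

/-! ### The random graph process -/

/-- Orderings of the `n.choose 2` unordered pairs of distinct elements of the vertex set `Fin n`;
the position of a pair is counted from `0`. -/
abbrev EdgeOrdering (n : ℕ) : Type :=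
  {e : Sym2 (Fin n) // ¬ e.IsDiag} ≃ Fin (n.choose 2)

/-- The graph `G_t` of the graph process of `π`: its edges are the first `t` pairs. -/
def graphProcess {n : ℕ} (π : EdgeOrdering n) (t : ℕ) : SimpleGraph (Fin n) :=
  SimpleGraph.fromEdgeSet
    {e | ∃ h : ¬ e.IsDiag, (π ⟨e, h⟩ : ℕ) < t}

/-- The hitting time of the property `P` in the graph process of `π`: the least
`t ∈ {0, …, n.choose 2}` such that `G_t` has property `P`, and `⊤` if there is no such `t`. -/
noncomputable def hittingTime {n : ℕ} (π : EdgeOrdering n) (P : SimpleGraph (Fin n) → Prop) : ℕ∞ :=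
  sInf ((fun t : ℕ => (t : ℕ∞)) '' {t : ℕ | t ≤ n.choose 2 ∧ P (graphProcess π t)})

theorem nonempty_edgeOrdering (n : ℕ) : Nonempty (EdgeOrdering n) :=
  ⟨Fintype.equivFinOfCardEq (by simpa using Sym2.card_subtype_not_diag (α := Fin n))⟩

/-- The probability of the event `A` when the ordering of the pairs is chosen uniformly at random. -/
noncomputable def processProb {n : ℕ} (A : Set (EdgeOrdering n)) : ℝ :=
  (A.ncard : ℝ) / (Nat.card (EdgeOrdering n) : ℝ)

/-! One inequality between the hitting times holds for every ordering. Moving first, Breaker can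
take at least half of the edges at any vertex, and a `k`-connected graph has minimum degree at least
`k`, so a Maker's win forces minimum degree `2k` (`MakerWinsGame.hasMinDegreeAtLeast`). It remains
to show that with high probability Maker already wins on `G_τ`, where `τ` is the hitting time of
minimum degree `2k`.

Fix three times `r < t₀ < t₁`, about `n log n / 20`, `9 n log n / 20` and `2 n log n`. At `t₀` some
vertex is isolated and at `t₁` all degrees are at least `2k`, so `t₀ ≤ τ ≤ t₁`. Call the first `r`
edges red and the edges at positions in `[r, t₀)` blue. A vertex is small if its blue degree is at
most `4D`, where `D` is a small multiple of `log n`. With high probability, no two small vertices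
are adjacent or have a common neighbour in `G_{t₁}`, every set of at most `s` vertices (`s` linear
in `n`) spans few edges of `G_{t₁}`, and any two disjoint sets of linear size have many red edges
between them. These conditions are monotone in the right direction, so they pass to `G_τ` and no
union over the possible values of `τ` is needed.

On `G_τ` Maker combines two strategies. By Hall's theorem (`exists_injective_pairs`) he reserves
disjoint pairs of edges: `k` pairs at each small vertex, among its at least `2k` edges, and `D`
pairs at each other vertex, among its blue edges to vertices that are not small. Whenever Breaker
takes one edge of a pair whose mate is free, Maker takes the mate. On all other moves he plays the
Erdős–Selfridge strategy on the unreserved red edges of the cuts between large sets; reserved edges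
carry no weight there, so the two strategies do not interfere
(`exists_strategy_pairing_transversal`). Maker's graph then has degree at least `k` at small
vertices and at least `D` elsewhere, and it meets every large cut. If fewer than `k` vertices
separated it, local sparseness would force both sides to be large, and the cut between them would
contain an edge of Maker (`isVertexConnected_of_expansion`).

The probabilistic estimates are made directly for uniform orderings. The generating function of the
number of elements of `X` placed in `A` is expanded over subsets, which gives the same exponential
tails as independence would. The isolated vertex comes from the second moment method. -/

namespace MakerBreaker

/-! ### Strategies in Maker-Breaker games: invariants, pairing and potential functions -/

variable {α : Type*} {X : Finset α}

theorem makerMoves_cons_of_even {h : List α} (hh : Even h.length) (x : α) :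
    makerMoves (x :: h) = makerMoves h := by
  simp [makerMoves, Nat.not_odd_iff_even.2 hh]

theorem makerMoves_cons_of_odd {h : List α} (hh : Odd h.length) (x : α) :
    makerMoves (x :: h) = x :: makerMoves h := by
  simp [makerMoves, hh]

/-- An invariant that Maker can restore after every move of Breaker gives a strategy which keeps
it. -/
theorem exists_strategy_of_invariant (Inv : List α → Prop) (h0 : Inv [])
    (step : ∀ h, Inv h → Even h.length → ∀ b ∈ X, b ∉ h → (∃ x ∈ X, x ∉ b :: h) →
      ∃ y, (y ∈ X ∧ y ∉ b :: h) ∧ Inv (y :: b :: h)) :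
    ∃ σ : MakerStrategy X, ∀ h, Follows σ h → (Even h.length → Inv h) ∧
      (Odd h.length → ∃ b h', h = b :: h' ∧ b ∈ X ∧ b ∉ h' ∧ Inv h' ∧ Even h'.length) := by
  classical
  -- Maker answers with any move that restores the invariant. The fallback to an arbitrary free
  -- element only makes the strategy total; it never occurs in a play that follows the strategy.
  refine ⟨fun h free => if H : ∃ y, (y ∈ X ∧ y ∉ h) ∧ Inv (y :: h) then ⟨H.choose, H.choose_spec.1⟩
    else ⟨free.choose, free.choose_spec⟩, fun h H => ?_⟩
  induction H with
  | start => exact ⟨fun _ => h0, fun h => by simp at h⟩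
  | @breaker h b _ he hb hbh ih =>
    refine ⟨fun h' => ?_, fun _ => ⟨b, h, rfl, hb, hbh, ih.1 he, he⟩⟩
    simp only [List.length_cons] at h'
    exact absurd he (by simpa [Nat.even_add_one] using h')
  | @maker h free _ ho ih =>
    refine ⟨fun _ => ?_, fun h' => ?_⟩
    · obtain ⟨b, h', rfl, hb, hbh, hI, he⟩ := ih.2 ho
      have H := step h' hI he b hb hbh free
      rw [dif_pos H]
      exact H.choose_spec.2
    · simp only [List.length_cons] at h'
      exact absurd ho (by simpa [Nat.odd_add_one] using h')

open Classical in
/-- Breaker, moving first, can claim at least half of any part of the board. -/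
theorem IsMakerWin.exists_two_mul_card_le {F : Set (Finset α)} (hw : IsMakerWin X F)
    {Z : Finset α} (hZ : Z ⊆ X) :
    ∃ W ∈ F, 2 * (Z.filter (· ∈ W)).card ≤ Z.card := by
  obtain ⟨σ, hσ⟩ := hw
  suffices key : ∀ (m : ℕ) (h : List α), (X.filter (· ∉ h)).card = m → Follows σ h →
      Even h.length →
      2 * (Z.filter (· ∈ makerMoves h)).card ≤ (Z.filter (· ∈ h)).card →
      ∃ h', Follows σ h' ∧ (∀ x ∈ X, x ∈ h') ∧ 2 * (Z.filter (· ∈ makerMoves h')).card ≤ Z.card by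
    obtain ⟨h, hf, hc, hz⟩ := key _ [] rfl .start (by simp) (by simp [makerMoves])
    obtain ⟨W, hW, hm⟩ := hσ h hf hc
    refine ⟨W, hW, le_trans ?_ hz⟩
    gcongr with x
    exact hm x
  intro m
  induction m using Nat.strong_induction_on with
  | _ m ih =>
  intro h hm hf he hc
  by_cases hX : ∀ x ∈ X, x ∈ h
  · exact ⟨h, hf, hX, hc.trans (Finset.card_filter_le _ _)⟩
  -- Breaker plays inside `Z` as long as `Z` has a free element. After that Maker cannot gain in `Z`
  -- either, which is what the last clause records.
  have hb : ∃ b ∈ X, b ∉ h ∧ (b ∉ Z → ∀ z ∈ Z, z ∈ h) := by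
    by_cases hz : ∀ z ∈ Z, z ∈ h
    · push Not at hX
      obtain ⟨b, hb, hbh⟩ := hX
      exact ⟨b, hb, hbh, fun _ => hz⟩
    · push Not at hz
      obtain ⟨b, hb, hbh⟩ := hz
      exact ⟨b, hZ hb, hbh, fun h => absurd hb h⟩
  obtain ⟨b, hbX, hbh, hbZ⟩ := hb
  have hf1 : Follows σ (b :: h) := .breaker hf he hbX hbh
  have hmm1 : makerMoves (b :: h) = makerMoves h := makerMoves_cons_of_even he b
  by_cases hX1 : ∀ x ∈ X, x ∈ b :: h
  · refine ⟨b :: h, hf1, hX1, ?_⟩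
    rw [hmm1]
    exact hc.trans (Finset.card_filter_le _ _)
  have free : ∃ x ∈ X, x ∉ b :: h := by push Not at hX1; exact hX1
  have ho : Odd (b :: h).length := by simpa using he.add_one
  have hf2 := Follows.maker free hf1 ho
  have hy := (σ (b :: h) free).2
  set y : α := (σ (b :: h) free : α)
  have hmm2 : makerMoves (y :: b :: h) = y :: makerMoves h := by
    rw [makerMoves_cons_of_odd ho, hmm1]
  refine ih _ ?_ (y :: b :: h) rfl hf2 (by simpa using ho.add_one) ?_
  · rw [← hm]
    apply Finset.card_lt_card
    rw [Finset.ssubset_iff_of_subset]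
    · exact ⟨b, by simp [hbX, hbh], by simp⟩
    · intro x
      simp only [Finset.mem_filter, List.mem_cons, not_or]
      tauto
  · rw [hmm2]
    by_cases hbz : b ∈ Z
    · have h1 : (Z.filter (· ∈ y :: makerMoves h)) ⊆ insert y (Z.filter (· ∈ makerMoves h)) := by
        intro x
        simp only [Finset.mem_filter, List.mem_cons, Finset.mem_insert]
        tauto
      by_cases hyz : y ∈ Z
      · have h2 : insert y (insert b (Z.filter (· ∈ h))) ⊆ Z.filter (· ∈ y :: b :: h) := by
          intro x
          simp only [Finset.mem_filter, List.mem_cons, Finset.mem_insert]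
          rintro (rfl | rfl | h) <;> simp_all
        have h3 := Finset.card_le_card h2
        have hyb : y ∉ b :: h := hy.2
        simp only [List.mem_cons, not_or] at hyb
        rw [Finset.card_insert_of_notMem, Finset.card_insert_of_notMem] at h3
        · have := (Finset.card_le_card h1).trans (Finset.card_insert_le _ _)
          omega
        · simp [hbh]
        · simp [hyb]
      · have h1 : (Z.filter (· ∈ y :: makerMoves h)) ⊆ (Z.filter (· ∈ makerMoves h)) := by
          intro x
          simp only [Finset.mem_filter, List.mem_cons]
          rintro ⟨hx, rfl | hx'⟩
          · exact absurd hx hyz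
          · exact ⟨hx, hx'⟩
        have h2 : (Z.filter (· ∈ h)) ⊆ Z.filter (· ∈ y :: b :: h) := by
          intro x
          simp only [Finset.mem_filter, List.mem_cons]
          tauto
        have := Finset.card_le_card h1
        have := Finset.card_le_card h2
        omega
    · have hyz : y ∉ Z := fun hyz => hy.2 (List.mem_cons_of_mem _ (hbZ hbz y hyz))
      have h1 : (Z.filter (· ∈ y :: makerMoves h)) ⊆ (Z.filter (· ∈ makerMoves h)) := by
        intro x
        simp only [Finset.mem_filter, List.mem_cons]
        rintro ⟨hx, rfl | hx'⟩
        · exact absurd hx hyz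
        · exact ⟨hx, hx'⟩
      have h2 : (Z.filter (· ∈ h)) ⊆ Z.filter (· ∈ y :: b :: h) := by
        intro x
        simp only [Finset.mem_filter, List.mem_cons]
        tauto
      have := Finset.card_le_card h1
      have := Finset.card_le_card h2
      omega

open Classical in
/-- The Erdős–Selfridge weight of the set `C` in a position: it is `0` if Maker has claimed an
element of `C`, and otherwise `2 ^ (-f)` where `f` is the number of unclaimed elements of `C`. -/
noncomputable def selfridgeWeight (C : Finset α) (h : List α) : ℝ :=
  if ∀ x ∈ C, x ∉ makerMoves h then (1 / 2 : ℝ) ^ (C.filter (· ∉ h)).card else 0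

theorem selfridgeWeight_nonneg (C : Finset α) (h : List α) : 0 ≤ selfridgeWeight C h := by
  unfold selfridgeWeight
  split_ifs <;> positivity

open Classical in
-- A move of Breaker in a set that Maker has not touched uses up one free element and so doubles the
-- weight of that set; all other weights stay the same. The increase of the total weight is
-- therefore the weight of the sets through the chosen element.
theorem selfridgeWeight_breaker (C : Finset α) {h : List α} (he : Even h.length) {b : α}
    (hb : b ∉ h) :
    selfridgeWeight C (b :: h) =
      selfridgeWeight C h + if b ∈ C then selfridgeWeight C h else 0 := by
  unfold selfridgeWeight
  rw [makerMoves_cons_of_even he]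
  by_cases hu : ∀ x ∈ C, x ∉ makerMoves h
  · rw [if_pos hu, if_pos hu]
    by_cases hbC : b ∈ C
    · have : C.filter (· ∉ h) = insert b (C.filter (· ∉ b :: h)) := by
        ext x
        simp only [Finset.mem_filter, List.mem_cons, Finset.mem_insert]
        by_cases hx : x = b
        · subst hx; simp [hbC, hb]
        · simp [hx]
      rw [if_pos hbC, this, Finset.card_insert_of_notMem (by simp), pow_succ]
      ring
    · have : C.filter (· ∉ h) = C.filter (· ∉ b :: h) := by
        ext x
        simp only [Finset.mem_filter, List.mem_cons]
        by_cases hx : x = b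
        · subst hx; simp [hbC]
        · simp [hx]
      rw [if_neg hbC, this, add_zero]
  · rw [if_neg hu, if_neg hu]
    simp

open Classical in
-- Maker's move kills the sets through the chosen element, so the total weight drops by exactly what
-- Breaker would have added with the same move.
theorem selfridgeWeight_maker (C : Finset α) {h : List α} (ho : Odd h.length) (y : α) :
    selfridgeWeight C (y :: h) =
      selfridgeWeight C h - if y ∈ C then selfridgeWeight C h else 0 := by
  unfold selfridgeWeight
  rw [makerMoves_cons_of_odd ho]
  by_cases hy : y ∈ C
  · rw [if_neg, if_pos hy, sub_self]
    push Not
    exact ⟨y, hy, by simp⟩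
  · have h1 : C.filter (· ∉ y :: h) = C.filter (· ∉ h) := by
      ext x
      simp only [Finset.mem_filter, List.mem_cons]
      by_cases hx : x = y
      · subst hx; simp [hy]
      · simp [hx]
    have h2 : (∀ x ∈ C, x ∉ y :: makerMoves h) ↔ ∀ x ∈ C, x ∉ makerMoves h := by
      refine forall₂_congr fun x hx => ?_
      have : x ≠ y := fun e => hy (e ▸ hx)
      simp [this]
    rw [if_neg hy, sub_zero, h1]
    simp only [h2]

open Classical in
/-- A pairing strategy combined with the Erdős–Selfridge strategy. -/
theorem exists_strategy_pairing_transversal {ι κ : Type*} [Fintype κ]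
    (f : ι × Bool → α) (hf : Function.Injective f) (hfX : ∀ i, f i ∈ X)
    (C : κ → Finset α) (hCX : ∀ j, C j ⊆ X) (hCf : ∀ j i, f i ∉ C j)
    (hsum : ∑ j, (1 / 2 : ℝ) ^ (C j).card < 1 / 2) :
    ∃ σ : MakerStrategy X, ∀ h, Follows σ h → (∀ x ∈ X, x ∈ h) →
      (∀ i, f (i, false) ∈ makerMoves h ∨ f (i, true) ∈ makerMoves h) ∧
      ∀ j, ∃ x ∈ C j, x ∈ makerMoves h := by
  set ψ : List α → ℝ := fun h => ∑ j, selfridgeWeight (C j) h with hψ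
  set w : List α → α → ℝ := fun h x => ∑ j, if x ∈ C j then selfridgeWeight (C j) h else 0 with hw
  have hψb : ∀ h : List α, Even h.length → ∀ b, b ∉ h → ψ (b :: h) = ψ h + w h b := by
    intro h he b hb
    simp only [hψ, hw, ← Finset.sum_add_distrib]
    exact Finset.sum_congr rfl fun j _ => selfridgeWeight_breaker _ he hb
  have hψm : ∀ h : List α, Odd h.length → ∀ y, ψ (y :: h) = ψ h - w h y := by
    intro h he b
    simp only [hψ, hw, ← Finset.sum_sub_distrib]
    exact Finset.sum_congr rfl fun j _ => selfridgeWeight_maker _ he _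
  have hw0 : ∀ h x, 0 ≤ w h x := fun h x => Finset.sum_nonneg fun j _ => by
    split_ifs
    exacts [selfridgeWeight_nonneg _ _, le_rfl]
  have hwψ : ∀ h x, w h x ≤ ψ h := fun h x => Finset.sum_le_sum fun j _ => by
    split_ifs
    exacts [le_rfl, selfridgeWeight_nonneg _ _]
  have hwm : ∀ h : List α, Odd h.length → ∀ y x, w (y :: h) x ≤ w h x := by
    intro h ho y x
    refine Finset.sum_le_sum fun j _ => ?_
    split_ifs
    · rw [selfridgeWeight_maker _ ho]
      have := selfridgeWeight_nonneg (C j) h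
      split_ifs <;> linarith
    · exact le_rfl
  have hwf : ∀ h i, w h (f i) = 0 := fun h i => Finset.sum_eq_zero fun j _ => by simp [hCf]
  have hwb : ∀ h : List α, Even h.length → ∀ i, f i ∉ h → ∀ x, w (f i :: h) x = w h x := by
    intro h he i hi x
    refine Finset.sum_congr rfl fun j _ => ?_
    rw [selfridgeWeight_breaker _ he hi]
    simp [hCf]
  -- Besides the state of the pairs, the invariant says that the total weight is below `1` and stays
  -- below `1` after any next move of Breaker. A set lost by Maker on a full board would have weight
  -- `1`.
  obtain ⟨σ, hσ⟩ := exists_strategy_of_invariant (X := X)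
    (fun h => (∀ i, (f (i, false) ∈ makerMoves h ∨ f (i, true) ∈ makerMoves h) ∨
      (f (i, false) ∉ h ∧ f (i, true) ∉ h)) ∧ ψ h < 1 ∧ ∀ x ∈ X, x ∉ h → ψ h + w h x < 1)
    (by
      -- The first move of Breaker at most doubles the total weight, hence the hypothesis with `1 /
      -- 2`.
      have : ψ [] < 1 / 2 := by
        simpa [hψ, selfridgeWeight, makerMoves] using hsum
      refine ⟨by simp, by linarith, fun x _ _ => ?_⟩
      linarith [hwψ [] x])
    (by
      rintro h ⟨hp, h1, h2⟩ he b hbX hbh free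
      have ho : Odd (b :: h).length := by simpa using he.add_one
      have hmm : ∀ y, makerMoves (y :: b :: h) = y :: makerMoves h := fun y => by
        rw [makerMoves_cons_of_odd ho, makerMoves_cons_of_even he]
      -- If Breaker breaks a pair, Maker must take the mate. Elements of pairs lie in no set `C j`,
      -- so neither move of this round changes a weight.
      by_cases hcase : ∃ i s, b = f (i, s) ∧ f (i, !s) ∉ h
      · obtain ⟨i, s, rfl, hm⟩ := hcase
        refine ⟨f (i, !s), ⟨hfX _, ?_⟩, ?_, ?_, ?_⟩
        · have : f (i, !s) ≠ f (i, s) := fun e => by simpa using hf e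
          simp [this, hm]
        · intro i'
          rw [hmm]
          by_cases hi : i' = i
          · subst hi
            left
            cases s <;> simp
          · rcases hp i' with h | h
            · left
              simp only [List.mem_cons]
              tauto
            · right
              simp only [List.mem_cons, hf.eq_iff, Prod.mk.injEq, hi]
              tauto
        · rw [hψm _ ho, hψb _ he _ hbh, hwf, hwf]
          linarith
        · intro x hx hxh
          rw [hψm _ ho, hψb _ he _ hbh, hwf, hwf]
          have h3 := hwm _ ho (f (i, !s)) x
          rw [hwb _ he _ hbh] at h3
          have := h2 x hx (fun hxx => hxh (by simp [hxx]))
          linarith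
      · push Not at hcase
        -- Otherwise Maker takes the free element of largest weight. What he removes is then at
        -- least what Breaker can add on his next move, so the weight bound after Breaker's present
        -- move persists.
        obtain ⟨y, hy, hmax⟩ := (X.filter (· ∉ b :: h)).exists_max_image (w (b :: h))
          (by obtain ⟨x, hx, hx'⟩ := free; exact ⟨x, Finset.mem_filter.2 ⟨hx, hx'⟩⟩)
        rw [Finset.mem_filter] at hy
        have h3 := h2 b hbX hbh
        refine ⟨y, hy, ?_, ?_, ?_⟩
        · intro i
          rw [hmm]
          rcases hp i with h | h
          · left
            simp only [List.mem_cons]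
            tauto
          · have hb1 : b ≠ f (i, false) := fun e => h.2 (hcase i false e)
            have hb2 : b ≠ f (i, true) := fun e => h.1 (hcase i true e)
            simp only [List.mem_cons]
            by_cases e1 : f (i, false) = y
            · tauto
            by_cases e2 : f (i, true) = y
            · tauto
            have := hb1.symm
            have := hb2.symm
            tauto
        · rw [hψm _ ho, hψb _ he _ hbh]
          linarith [hw0 (b :: h) y]
        · intro x hx hxh
          rw [hψm _ ho, hψb _ he _ hbh]
          have h4 := hwm _ ho y x
          have h5 := hmax x (Finset.mem_filter.2 ⟨hx, fun h => hxh (List.mem_cons_of_mem _ h)⟩)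
          linarith)
  have hone : ∀ h : List α, (∀ x ∈ X, x ∈ h) → ∀ j, (¬ ∃ x ∈ C j, x ∈ makerMoves h) →
      1 ≤ ψ h := by
    intro h hX j hj
    push Not at hj
    have : selfridgeWeight (C j) h = 1 := by
      rw [selfridgeWeight, if_pos hj, Finset.filter_false_of_mem, Finset.card_empty, pow_zero]
      exact fun x hx => not_not.2 (hX x (hCX j hx))
    rw [← this]
    exact Finset.single_le_sum (f := fun j => selfridgeWeight (C j) h)
      (fun j _ => selfridgeWeight_nonneg _ _) (Finset.mem_univ j)
  refine ⟨σ, fun h H hX => ?_⟩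
  -- On a board of odd size Breaker makes the last move and Maker cannot answer it. In that case the
  -- invariant is read one move earlier, and its third clause covers the last move.
  rcases Nat.even_or_odd h.length with he | ho
  · obtain ⟨hp, h1, -⟩ := (hσ h H).1 he
    refine ⟨fun i => (hp i).resolve_right fun h' => h'.1 (hX _ (hfX _)), fun j => ?_⟩
    by_contra hj
    exact absurd (hone h hX j hj) (not_le.2 h1)
  · obtain ⟨b, h', rfl, hbX, hbh, ⟨hp, h1, h2⟩, he⟩ := (hσ h H).2 ho
    rw [makerMoves_cons_of_even he]
    refine ⟨fun i => (hp i).resolve_right fun h'' => ?_, fun j => ?_⟩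
    · have e1 := hX _ (hfX (i, false))
      have e2 := hX _ (hfX (i, true))
      simp only [List.mem_cons, h''.1, h''.2, or_false] at e1 e2
      simpa using hf (e1.trans e2.symm)
    · by_contra hj
      have := hone _ hX j (by rwa [makerMoves_cons_of_even he])
      rw [hψb _ he _ hbh] at this
      exact absurd (h2 b hbX hbh) (not_lt.2 this)

end MakerBreaker

/-! ### Minimum degree as a necessary condition -/

open Classical in
-- If `v` had fewer than `k` neighbours, their removal would isolate `v` while leaving another
-- vertex, since there are more than `k` vertices.
theorem IsVertexConnected.le_card_neighbors {V : Type*} [Fintype V] {k : ℕ} {H : SimpleGraph V}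
    (hH : IsVertexConnected k H) (v : V) : k ≤ (Finset.univ.filter (H.Adj v)).card := by
  by_contra! hlt
  set S := Finset.univ.filter (H.Adj v) with hS
  have hvS : v ∉ S := by simp [hS]
  have hconn := hH.2 S hlt
  have hc : (insert v S).card < Fintype.card V :=
    (Finset.card_insert_le _ _).trans_lt (by have := hH.1; omega)
  obtain ⟨u, hu⟩ : ∃ u, u ∉ insert v S := by
    by_contra! h
    rw [(Finset.eq_univ_iff_forall.2 h), Finset.card_univ] at hc
    exact lt_irrefl _ hc
  simp only [Finset.mem_insert, not_or] at hu
  have : Nontrivial ((S : Set V)ᶜ : Set V) :=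
    ⟨⟨⟨v, by simpa using hvS⟩, ⟨u, by simpa using hu.2⟩, fun e => hu.1 (congrArg Subtype.val e).symm⟩⟩
  obtain ⟨w, hw⟩ := hconn.preconnected.exists_adj_of_nontrivial ⟨v, by simpa using hvS⟩
  have h1 : H.Adj v w := hw
  exact w.2 (by simpa [hS] using h1)

open Classical in
theorem hasMinDegreeAtLeast_iff {V : Type*} [Fintype V] [Nonempty V] (d : ℕ) (G : SimpleGraph V) :
    HasMinDegreeAtLeast d G ↔ ∀ v, d ≤ (Finset.univ.filter (G.Adj v)).card := by
  have hd : ∀ v, G.degree v = (Finset.univ.filter (G.Adj v)).card := fun v => by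
    rw [← SimpleGraph.card_neighborFinset_eq_degree]
    congr 1
    ext
    simp
  constructor
  · intro h v
    rw [← hd]
    exact le_trans h (G.minDegree_le_degree v)
  · intro h
    refine G.le_minDegree_of_forall_le_degree _ fun v => ?_
    rw [hd]
    exact h v

open Classical in
-- Breaker concentrates on the star at `v` and gets at least half of it, while Maker needs `k` edges
-- of this star.
theorem MakerBreaker.MakerWinsGame.hasMinDegreeAtLeast {V : Type*} [Fintype V] {k : ℕ}
    {G : SimpleGraph V} (h : MakerWinsGame (IsVertexConnected k) G) :
    HasMinDegreeAtLeast (2 * k) G := by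
  have hne : Nonempty V := by
    obtain ⟨W, hW, -⟩ := IsMakerWin.exists_two_mul_card_le h (Finset.empty_subset _)
    exact Fintype.card_pos_iff.1 ((Nat.zero_le k).trans_lt hW.2.1)
  rw [hasMinDegreeAtLeast_iff]
  intro v
  have hinj : Function.Injective fun u : V => s(v, u) := fun a b hab => Sym2.congr_right.1 hab
  obtain ⟨W, hW, hc⟩ := IsMakerWin.exists_two_mul_card_le h
    (Z := (Finset.univ.filter (G.Adj v)).image fun u => s(v, u)) (by
      intro e he
      obtain ⟨u, hu, rfl⟩ := Finset.mem_image.1 he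
      simpa using hu)
  rw [Finset.card_image_of_injective _ hinj] at hc
  refine le_trans ?_ hc
  have h1 := hW.2.le_card_neighbors v
  refine Nat.mul_le_mul_left 2 (h1.trans ?_)
  rw [← Finset.card_image_of_injective _ hinj]
  apply Finset.card_le_card
  intro e he
  obtain ⟨u, hu, rfl⟩ := Finset.mem_image.1 he
  simp only [Finset.mem_filter, Finset.mem_univ, true_and, SimpleGraph.fromEdgeSet_adj,
    Finset.mem_coe] at hu
  have hG : G.Adj v u := by simpa using hW.1 (Finset.mem_coe.2 hu.1)
  simp only [Finset.mem_filter, Finset.mem_image, Finset.mem_univ, true_and]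
  exact ⟨⟨u, hG, rfl⟩, hu.1⟩

/-! ### Maker's win on a pseudorandom graph -/

open Classical in
/-- Disjoint systems of pairs: `m v` pairs from `cand v` for every `v`, when no element belongs to
more than two of the sets `cand v`, and the sets with `v ∈ S` meet no other. -/
theorem exists_injective_pairs {V α : Type*} [Fintype V] (m : V → ℕ) (cand : V → Finset α)
    (S : Finset V) (hs : ∀ v ∈ S, 2 * m v ≤ (cand v).card)
    (hl : ∀ v ∉ S, 4 * m v ≤ (cand v).card)
    (he1 : ∀ e, ∀ u ∈ S, ∀ v, e ∈ cand u → e ∈ cand v → u = v)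
    (he2 : ∀ e, (Finset.univ.filter fun v => e ∈ cand v).card ≤ 2) :
    ∃ f : (Σ v, Fin (m v)) × Bool → α, Function.Injective f ∧ ∀ i, f i ∈ cand i.1.1 := by
  refine (Finset.all_card_le_biUnion_card_iff_exists_injective
    fun i : (Σ v, Fin (m v)) × Bool => cand i.1.1).1 fun s => ?_
  -- Hall's condition: only the set `Y` of vertices that occur in `s` matters, and the union of
  -- their candidate sets must have at least `∑ v ∈ Y, 2 * m v` elements.
  set Y := s.image fun i => i.1.1 with hY
  have h1 : s.card ≤ ∑ v ∈ Y, 2 * m v := by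
    have : s ⊆ (Y.sigma fun v => (Finset.univ : Finset (Fin (m v)))) ×ˢ Finset.univ := by
      intro i hi
      simp only [Finset.mem_product, Finset.mem_sigma, Finset.mem_univ, and_true]
      exact Finset.mem_image_of_mem _ hi
    refine (Finset.card_le_card this).trans (le_of_eq ?_)
    simp [Finset.card_product, Finset.card_sigma, Finset.mul_sum, mul_comm]
  have hU : s.biUnion (fun i => cand i.1.1) = Y.biUnion cand := by
    rw [hY, Finset.image_biUnion]
  rw [hU]
  set U := Y.biUnion cand
  -- Count incidences between vertices and candidates, with weight `2` on `S`. Each vertex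
  -- contributes at least `4 * m v`. Each element contributes at most `2`: it lies in one set of
  -- weight `2` and no other, or in at most two sets of weight `1`.
  set c : V → ℕ := fun v => if v ∈ S then 2 else 1 with hc
  have h2 : ∑ v ∈ Y, 2 * (2 * m v) ≤ ∑ v ∈ Y, ∑ e ∈ U, if e ∈ cand v then c v else 0 := by
    refine Finset.sum_le_sum fun v hv => ?_
    have : U.filter (· ∈ cand v) = cand v := by
      ext e
      simp only [Finset.mem_filter, and_iff_right_iff_imp]
      exact fun he => Finset.mem_biUnion.2 ⟨v, hv, he⟩
    rw [← Finset.sum_filter, this, Finset.sum_const, smul_eq_mul, hc]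
    by_cases h : v ∈ S
    · have := hs v h
      simp only [h, if_true]
      omega
    · have := hl v h
      simp only [h, if_false]
      omega
  rw [Finset.sum_comm] at h2
  have h3 : ∑ e ∈ U, ∑ v ∈ Y, (if e ∈ cand v then c v else 0) ≤ ∑ e ∈ U, 2 := by
    refine Finset.sum_le_sum fun e _ => ?_
    rw [← Finset.sum_filter]
    by_cases hex : ∃ u ∈ S, e ∈ cand u
    · obtain ⟨u, hu, heu⟩ := hex
      have hsub : Y.filter (fun v => e ∈ cand v) ⊆ {u} := by
        intro v hv
        rw [Finset.mem_singleton]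
        exact (he1 e u hu v heu (Finset.mem_filter.1 hv).2).symm
      refine (Finset.sum_le_sum_of_subset hsub).trans ?_
      simp only [hc, Finset.sum_singleton]
      split_ifs
      omega
    · push Not at hex
      have : ∀ v ∈ Y.filter (fun v => e ∈ cand v), c v = 1 := by
        intro v hv
        have : v ∉ S := fun h => hex v h (Finset.mem_filter.1 hv).2
        simp [hc, this]
      rw [Finset.sum_congr rfl this, Finset.sum_const, smul_eq_mul, mul_one]
      refine le_trans (Finset.card_le_card ?_) (he2 e)
      exact Finset.filter_subset_filter _ (Finset.subset_univ _)
  rw [← Finset.mul_sum] at h2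
  rw [Finset.sum_const, smul_eq_mul] at h3
  omega

/-- A failure of connectivity after the removal of `S` splits the other vertices in two nonempty
parts with no edges between them. -/
theorem SimpleGraph.exists_partition_of_not_connected {V : Type*} {H : SimpleGraph V}
    {S : Set V} (hS : (Sᶜ).Nonempty) (h : ¬ (H.induce Sᶜ).Connected) :
    ∃ A B : Set V, A.Nonempty ∧ B.Nonempty ∧ Disjoint A B ∧ (∀ v, v ∈ A ∨ v ∈ B ∨ v ∈ S) ∧
      ∀ a ∈ A, ∀ b ∈ B, ¬ H.Adj a b := by
  have : Nonempty (Sᶜ : Set V) := hS.to_subtype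
  have hp : ¬ (H.induce Sᶜ).Preconnected := fun hp => h ⟨hp⟩
  simp only [SimpleGraph.Preconnected, not_forall] at hp
  obtain ⟨x, y, hxy⟩ := hp
  refine ⟨{v | ∃ hv : v ∈ Sᶜ, (H.induce Sᶜ).Reachable x ⟨v, hv⟩},
    {v | ∃ hv : v ∈ Sᶜ, ¬ (H.induce Sᶜ).Reachable x ⟨v, hv⟩}, ⟨x, x.2, .rfl⟩, ⟨y, y.2, hxy⟩,
    ?_, ?_, ?_⟩
  · rw [Set.disjoint_left]
    rintro v ⟨hv, h1⟩ ⟨_, h2⟩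
    exact h2 h1
  · intro v
    by_cases hv : v ∈ S
    · exact .inr (.inr hv)
    by_cases hr : (H.induce Sᶜ).Reachable x ⟨v, hv⟩
    · exact .inl ⟨hv, hr⟩
    · exact .inr (.inl ⟨hv, hr⟩)
  · rintro a ⟨ha, hra⟩ b ⟨hb, hrb⟩ hab
    refine hrb (hra.trans (SimpleGraph.Adj.reachable ?_))
    exact hab

open Classical in
/-- A graph `H ≤ G` of large minimum degree outside a scattered set `Sm` of vertices is
`k`-connected, if `G` is locally sparse and `H` meets all large cuts. -/
theorem isVertexConnected_of_expansion {V : Type*} [Fintype V] {G H : SimpleGraph V}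
    {Sm : Finset V} {k b D s : ℕ} (hk : 1 ≤ k) (hcard : k < Fintype.card V) (hH : H ≤ G)
    (hsmall : ∀ v ∈ Sm, k ≤ (Finset.univ.filter (H.Adj v)).card)
    (hlarge : ∀ v ∉ Sm, D ≤ (Finset.univ.filter (H.Adj v)).card)
    (hsm1 : ∀ u ∈ Sm, ∀ v ∈ Sm, ¬ G.Adj u v)
    (hsm2 : ∀ u ∈ Sm, ∀ v ∈ Sm, u ≠ v → ∀ w, G.Adj u w → ¬ G.Adj v w)
    (hsparse : ∀ T : Finset V, T.Nonempty → T.card ≤ s →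
      ((T ×ˢ T).filter fun p => G.Adj p.1 p.2).card < 2 * b * T.card)
    (hD : 2 * b * k + 1 ≤ D)
    (hcut : ∀ A B : Finset V, Disjoint A B → s < A.card + k → s < B.card + k →
      ∃ a ∈ A, ∃ b ∈ B, H.Adj a b) :
    IsVertexConnected k H := by
  -- Every nonempty set with all outside neighbours in fewer than `k` vertices must be large.
  -- Applied to both sides of a separation, this puts the cut in the range of `hcut`.
  have key : ∀ A S : Finset V, A.Nonempty → S.card < k →
      (∀ a ∈ A, ∀ u, H.Adj a u → u ∈ A ∨ u ∈ S) → s < A.card + k := by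
    intro A S hA hS hN
    set Al := A \ Sm with hAl
    have hAlA : Al.card ≤ A.card := Finset.card_le_card Finset.sdiff_subset
    rcases Al.eq_empty_or_nonempty with h0 | hne
    · obtain ⟨v, hv⟩ := hA
      have hASm : ∀ u ∈ A, u ∈ Sm := fun u hu => by
        by_contra h
        exact Finset.notMem_empty u (h0 ▸ Finset.mem_sdiff.2 ⟨hu, h⟩)
      have hsub : Finset.univ.filter (H.Adj v) ⊆ S := by
        intro u hu
        have hu := (Finset.mem_filter.1 hu).2
        refine (hN v hv u hu).resolve_left fun huA => ?_
        exact hsm1 v (hASm v hv) u (hASm u huA) (hH hu)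
      have := Finset.card_le_card hsub
      have := hsmall v (hASm v hv)
      omega
    · set T := Al ∪ S with hT
      have hTc : T.card ≤ Al.card + S.card := Finset.card_union_le _ _
      by_contra hlt
      have hTs : T.card ≤ s := by omega
      have hsp := hsparse T (hne.mono Finset.subset_union_left) hTs
      -- One neighbour is lost at most: two small neighbours of `v` would be small vertices with a
      -- common neighbour.
      have hdeg : ∀ v ∈ Al, D - 1 ≤ (T.filter (H.Adj v)).card := by
        intro v hv
        rw [hAl, Finset.mem_sdiff] at hv
        have h1 := hlarge v hv.2
        have h2 : Finset.univ.filter (H.Adj v) ⊆ T.filter (H.Adj v) ∪ Sm.filter (H.Adj v) := by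
          intro u hu
          have hu := (Finset.mem_filter.1 hu).2
          rw [Finset.mem_union, Finset.mem_filter, Finset.mem_filter]
          by_cases huS : u ∈ Sm
          · exact .inr ⟨huS, hu⟩
          · left
            refine ⟨?_, hu⟩
            rw [hT, Finset.mem_union, hAl, Finset.mem_sdiff]
            rcases hN v hv.1 u hu with h | h
            · exact .inl ⟨h, huS⟩
            · exact .inr h
        have h3 : (Sm.filter (H.Adj v)).card ≤ 1 := by
          refine Finset.card_le_one.2 fun x hx y hy => ?_
          rw [Finset.mem_filter] at hx hy
          by_contra hxy
          exact hsm2 x hx.1 y hy.1 hxy v (hH hx.2.symm) (hH hy.2.symm)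
        have := (Finset.card_le_card h2).trans (Finset.card_union_le _ _)
        omega
      have hsum : ∑ v ∈ Al, (T.filter (H.Adj v)).card ≤
          ((T ×ˢ T).filter fun p => G.Adj p.1 p.2).card := by
        rw [← Finset.card_sigma]
        refine Finset.card_le_card_of_injOn (fun x => (x.1, x.2)) ?_ ?_
        · rintro ⟨x, y⟩ hx
          simp only [Finset.coe_sigma, Set.mem_sigma_iff, Finset.mem_coe, Finset.mem_filter] at hx
          simp only [Finset.mem_coe, Finset.mem_filter, Finset.mem_product]
          exact ⟨⟨Finset.mem_union_left _ hx.1, hx.2.1⟩, hH hx.2.2⟩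
        · rintro ⟨x, y⟩ - ⟨x', y'⟩ - h
          simp only [Prod.mk.injEq] at h
          obtain ⟨rfl, rfl⟩ := h
          rfl
      have h4 : Al.card * (D - 1) ≤ ∑ v ∈ Al, (T.filter (H.Adj v)).card := by
        rw [← smul_eq_mul]
        exact Finset.card_nsmul_le_sum _ _ _ hdeg
      -- Since `Al` is nonempty, `|S| ≤ k - 1 ≤ (k - 1) |Al|`. With `D - 1 ≥ 2 b k`, the degrees
      -- inside `T` then contradict sparseness.
      have h5 : T.card ≤ k * Al.card := by
        have : 1 ≤ Al.card := hne.card_pos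
        have h6 : k - 1 ≤ (k - 1) * Al.card := Nat.le_mul_of_pos_right _ this
        have h7 : k * Al.card = (k - 1) * Al.card + Al.card := by
          conv_lhs => rw [show k = (k - 1) + 1 by omega]
          ring
        omega
      have h6 : 2 * b * T.card ≤ 2 * b * (k * Al.card) := Nat.mul_le_mul_left _ h5
      have h7 : Al.card * (2 * b * k) ≤ Al.card * (D - 1) := Nat.mul_le_mul_left _ (by omega)
      have h8 : Al.card * (2 * b * k) = 2 * b * (k * Al.card) := by ring
      omega
  refine ⟨hcard, fun S hS => ?_⟩
  by_contra hcon
  obtain ⟨A, B, hA, hB, hAB, hcov, hno⟩ := SimpleGraph.exists_partition_of_not_connected (by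
    obtain ⟨u, hu⟩ : ∃ u, u ∉ S := by
      by_contra! h
      rw [(Finset.eq_univ_iff_forall.2 h), Finset.card_univ] at hS
      omega
    exact ⟨u, by simpa using hu⟩) hcon
  have hA' := key A.toFinset S (by simpa using hA) hS (by
    intro a ha u hu
    simp only [Set.mem_toFinset] at ha ⊢
    rcases hcov u with h | h | h
    · exact .inl h
    · exact absurd hu (hno a ha u h)
    · exact .inr (by simpa using h))
  have hB' := key B.toFinset S (by simpa using hB) hS (by
    intro a ha u hu
    simp only [Set.mem_toFinset] at ha ⊢
    rcases hcov u with h | h | h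
    · exact absurd hu.symm (hno u h a ha)
    · exact .inl h
    · exact .inr (by simpa using h))
  obtain ⟨a, ha, b, hb, hab⟩ := hcut _ _ (by simpa using hAB) hA' hB'
  exact hno a (by simpa using ha) b (by simpa using hb) hab

open Classical in
-- The deterministic core. Red edges `R` serve the cuts and blue edges `B` serve the degrees of the
-- vertices outside `Sm`. As the two colours are disjoint, only the few pairs reserved at vertices
-- of `Sm` can take edges away from the cuts.
theorem makerWinsGame_isVertexConnected {V : Type*} [Fintype V] {G R B : SimpleGraph V}
    {Sm : Finset V} {k b D s : ℕ} (hk : 1 ≤ k) (hcard : k < Fintype.card V) (hR : R ≤ G)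
    (hB : B ≤ G) (hRB : Disjoint R B)
    (hdeg : ∀ v, 2 * k ≤ (Finset.univ.filter (G.Adj v)).card)
    (hlarge : ∀ v ∉ Sm, 4 * D + 1 ≤ (Finset.univ.filter (B.Adj v)).card)
    (hsm1 : ∀ u ∈ Sm, ∀ v ∈ Sm, ¬ G.Adj u v)
    (hsm2 : ∀ u ∈ Sm, ∀ v ∈ Sm, u ≠ v → ∀ w, G.Adj u w → ¬ G.Adj v w)
    (hsparse : ∀ T : Finset V, T.Nonempty → T.card ≤ s →
      ((T ×ˢ T).filter fun p => G.Adj p.1 p.2).card < 2 * b * T.card)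
    (hD : 2 * b * k + 1 ≤ D)
    (hcut : ∀ A A' : Finset V, Disjoint A A' → s < A.card + k → s < A'.card + k →
      2 * (k + 1) * Fintype.card V + 2 ≤ ((A ×ˢ A').filter fun p => R.Adj p.1 p.2).card) :
    MakerBreaker.MakerWinsGame (IsVertexConnected k) G := by
  have hinj : ∀ v : V, Function.Injective fun u : V => s(v, u) :=
    fun v a b hab => Sym2.congr_right.1 hab
  set m : V → ℕ := fun v => if v ∈ Sm then k else D with hm
  -- Edges to `Sm` are excluded at vertices outside `Sm`, so that a candidate of a vertex in `Sm` is
  -- a candidate of no other vertex. This costs at most one edge per vertex, hence the `+ 1` in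
  -- `hlarge`.
  set cand : V → Finset (Sym2 V) := fun v =>
    if v ∈ Sm then (Finset.univ.filter (G.Adj v)).image fun u => s(v, u)
    else (Finset.univ.filter fun u => u ∉ Sm ∧ B.Adj v u).image fun u => s(v, u) with hcand
  have hcs : ∀ v ∈ Sm, ∀ e, e ∈ cand v ↔ ∃ u, G.Adj v u ∧ s(v, u) = e := by
    intro v hv e
    simp [hcand, hv]
  have hcl : ∀ v ∉ Sm, ∀ e, e ∈ cand v ↔ ∃ u, (u ∉ Sm ∧ B.Adj v u) ∧ s(v, u) = e := by
    intro v hv e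
    simp [hcand, hv]
  have hcG : ∀ v, ∀ e ∈ cand v, ∃ u, G.Adj v u ∧ s(v, u) = e := by
    intro v e he
    by_cases hv : v ∈ Sm
    · exact (hcs v hv e).1 he
    · obtain ⟨u, hu, h⟩ := (hcl v hv e).1 he
      exact ⟨u, hB hu.2, h⟩
  obtain ⟨f, hf, hfc⟩ := exists_injective_pairs m cand Sm (by
      intro v hv
      simp only [hm, hcand, hv, if_true]
      rw [Finset.card_image_of_injective _ (hinj v)]
      exact hdeg v) (by
      intro v hv
      simp only [hm, hcand, hv, if_false]
      rw [Finset.card_image_of_injective _ (hinj v)]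
      have h1 := hlarge v hv
      have h2 : Finset.univ.filter (B.Adj v) ⊆
          Finset.univ.filter (fun u => u ∉ Sm ∧ B.Adj v u) ∪ Sm.filter (B.Adj v) := by
        intro u
        simp only [Finset.mem_union, Finset.mem_filter, Finset.mem_univ, true_and]
        tauto
      have h3 : (Sm.filter (B.Adj v)).card ≤ 1 := by
        refine Finset.card_le_one.2 fun x hx y hy => ?_
        rw [Finset.mem_filter] at hx hy
        by_contra hxy
        exact hsm2 x hx.1 y hy.1 hxy v (hB hx.2.symm) (hB hy.2.symm)
      have := (Finset.card_le_card h2).trans (Finset.card_union_le _ _)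
      omega) (by
      intro e u hu v heu hev
      obtain ⟨x, hx, rfl⟩ := (hcs u hu e).1 heu
      by_cases hv : v ∈ Sm
      · obtain ⟨y, hy, h⟩ := (hcs v hv _).1 hev
        rcases Sym2.eq_iff.1 h with h | h
        · exact h.1.symm
        · exact absurd (h.1 ▸ hx) (hsm1 u hu v hv)
      · obtain ⟨y, hy, h⟩ := (hcl v hv _).1 hev
        rcases Sym2.eq_iff.1 h with h | h
        · exact h.1.symm
        · exact absurd hu (h.2 ▸ hy.1)) (by
      intro e
      induction e using Sym2.ind with
      | _ x y =>
        refine le_trans (Finset.card_le_card (t := {x, y}) ?_) Finset.card_le_two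
        intro v hv
        simp only [Finset.mem_filter, Finset.mem_univ, true_and] at hv
        obtain ⟨u, hu, h⟩ := hcG v _ hv
        rcases Sym2.eq_iff.1 h with h | h
        · simp [h.1]
        · simp [h.1])
  set used := Finset.univ.image f with hused
  set κ := {p : Finset V × Finset V // Disjoint p.1 p.2 ∧ s < p.1.card + k ∧ s < p.2.card + k}
  set cut : Finset V × Finset V → Finset (Sym2 V) := fun p =>
    ((p.1 ×ˢ p.2).filter fun q => R.Adj q.1 q.2).image fun q => s(q.1, q.2) with hcutdef
  have hcutR : ∀ p, ∀ e ∈ cut p, e ∈ R.edgeSet := by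
    intro p e he
    obtain ⟨q, hq, rfl⟩ := Finset.mem_image.1 he
    exact (Finset.mem_filter.1 hq).2
  -- At most `2 k |V|` reserved edges are red, namely two for each pair at a vertex of `Sm`. From
  -- the `2 (k + 1) |V| + 2` red edges of a cut there remain `2 (|V| + 1)`.
  have hcutcard : ∀ p : κ, 2 * (Fintype.card V + 1) ≤ (cut p.1 \ used).card := by
    rintro ⟨⟨A, A'⟩, hd, hA, hA'⟩
    have h1 := hcut A A' hd hA hA'
    have h2 : (cut (A, A')).card = ((A ×ˢ A').filter fun p => R.Adj p.1 p.2).card := by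
      refine Finset.card_image_of_injOn ?_
      rintro ⟨x, y⟩ hx ⟨x', y'⟩ hx' h
      simp only [Finset.coe_filter, Finset.mem_product, Set.mem_ofPred_eq] at hx hx'
      rcases Sym2.eq_iff.1 h with h | h
      · exact Prod.ext h.1 h.2
      · have h1 : x = y' := h.1
        exact absurd (h1 ▸ hx'.1.2) (Finset.disjoint_left.1 hd hx.1.1)
    have h3 : cut (A, A') ∩ used ⊆
        ((Finset.univ.sigma fun v => (Finset.univ : Finset (Fin (m v)))).filter
          (fun i => i.1 ∈ Sm) ×ˢ Finset.univ).image f := by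
      intro e he
      rw [Finset.mem_inter] at he
      obtain ⟨i, -, rfl⟩ := Finset.mem_image.1 he.2
      refine Finset.mem_image_of_mem _ ?_
      simp only [Finset.mem_product, Finset.mem_filter, Finset.mem_sigma, Finset.mem_univ,
        true_and, and_true]
      by_contra hi
      obtain ⟨u, hu, h⟩ := (hcl _ hi _).1 (hfc i)
      have h4 := hcutR _ _ he.1
      rw [← h, SimpleGraph.mem_edgeSet] at h4
      exact (SimpleGraph.disjoint_left.1 hRB) _ _ h4 hu.2
    have h4 : (cut (A, A') ∩ used).card ≤ 2 * k * Fintype.card V := by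
      refine (Finset.card_le_card h3).trans (Finset.card_image_le.trans ?_)
      rw [Finset.card_product]
      have : ((Finset.univ.sigma fun v => (Finset.univ : Finset (Fin (m v)))).filter
          (fun i => i.1 ∈ Sm)) = Sm.sigma fun v => (Finset.univ : Finset (Fin (m v))) := by
        ext i
        simp
      rw [this, Finset.card_sigma]
      have h5 : ∑ a ∈ Sm, (Finset.univ : Finset (Fin (m a))).card = Sm.card * k := by
        rw [← smul_eq_mul, ← Finset.sum_const]
        refine Finset.sum_congr rfl fun v hv => ?_
        simp [hm, hv]
      rw [h5]
      have := Finset.card_le_univ Sm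
      simp only [Finset.card_univ, Fintype.card_bool]
      nlinarith
    have h5 := Finset.card_sdiff_add_card_inter (cut (A, A')) used
    have h6 : 2 * (k + 1) * Fintype.card V = 2 * k * Fintype.card V + 2 * Fintype.card V := by ring
    simp only
    omega
  obtain ⟨σ, hσ⟩ := MakerBreaker.exists_strategy_pairing_transversal (X := G.edgeFinset) f hf
    (by
      intro i
      obtain ⟨u, hu, h⟩ := hcG _ _ (hfc i)
      rw [← h]
      simpa using hu)
    (fun p : κ => cut p.1 \ used)
    (by
      intro p e he
      have := hcutR _ e (Finset.mem_sdiff.1 he).1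
      rw [SimpleGraph.mem_edgeFinset]
      exact SimpleGraph.edgeSet_mono hR this)
    (by
      intro p i hi
      exact (Finset.mem_sdiff.1 hi).2 (Finset.mem_image_of_mem _ (Finset.mem_univ _)))
    (by
      -- There are at most `4 ^ |V|` cuts, each of weight at most `4 ^ (-(|V| + 1))`, so the initial
      -- potential is at most `1 / 4`.
      have h1 : ∑ p : κ, (1 / 2 : ℝ) ^ (cut p.1 \ used).card ≤
          ∑ p : κ, (1 / 2 : ℝ) ^ (2 * (Fintype.card V + 1)) :=
        Finset.sum_le_sum fun p _ =>
          pow_le_pow_of_le_one (by norm_num) (by norm_num) (hcutcard p)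
      refine h1.trans_lt ?_
      rw [Finset.sum_const, nsmul_eq_mul, Finset.card_univ]
      have h2 : Fintype.card κ ≤ 4 ^ Fintype.card V := by
        refine (Fintype.card_subtype_le _).trans (le_of_eq ?_)
        rw [Fintype.card_prod, Fintype.card_finset, show (4 : ℕ) = 2 * 2 from rfl, mul_pow]
      have h3 : (Fintype.card κ : ℝ) ≤ 4 ^ Fintype.card V := by exact_mod_cast h2
      have h4 : (1 / 2 : ℝ) ^ (2 * (Fintype.card V + 1)) = (1 / 4) * (4 ^ Fintype.card V)⁻¹ := by
        rw [pow_mul, pow_succ, ← inv_pow]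
        norm_num
        ring
      rw [h4]
      have h5 : (0 : ℝ) < 4 ^ Fintype.card V := by positivity
      calc (Fintype.card κ : ℝ) * (1 / 4 * (4 ^ Fintype.card V)⁻¹)
          ≤ 4 ^ Fintype.card V * (1 / 4 * (4 ^ Fintype.card V)⁻¹) := by gcongr
        _ = 1 / 4 := by field_simp
        _ < 1 / 2 := by norm_num)
  refine ⟨σ, fun h hh hX => ?_⟩
  obtain ⟨hp, hc⟩ := hσ h hh hX
  set W := G.edgeFinset.filter (· ∈ MakerBreaker.makerMoves h) with hW
  have hWG : (W : Set (Sym2 V)) ⊆ G.edgeSet := by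
    intro e he
    have := (Finset.mem_filter.1 (Finset.mem_coe.1 he)).1
    simpa using this
  refine ⟨W, ⟨hWG, ?_⟩, fun x hx => (Finset.mem_filter.1 hx).2⟩
  obtain ⟨H, hH⟩ : ∃ H, H = SimpleGraph.fromEdgeSet (W : Set (Sym2 V)) := ⟨_, rfl⟩
  rw [← hH]
  have hHG : H ≤ G := by
    intro u v huv
    rw [hH, SimpleGraph.fromEdgeSet_adj] at huv
    simpa using hWG huv.1
  have hdegH : ∀ v, m v ≤ (Finset.univ.filter (H.Adj v)).card := by
    intro v
    have h1 : ∀ i : Fin (m v), ∃ u s, H.Adj v u ∧ s(v, u) = f (⟨v, i⟩, s) := by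
      intro i
      have : ∃ s, f (⟨v, i⟩, s) ∈ MakerBreaker.makerMoves h := by
        rcases hp ⟨v, i⟩ with h | h
        exacts [⟨_, h⟩, ⟨_, h⟩]
      obtain ⟨s, hs⟩ := this
      obtain ⟨u, hu, h⟩ := hcG _ _ (hfc (⟨v, i⟩, s))
      refine ⟨u, s, ?_, h⟩
      rw [hH, SimpleGraph.fromEdgeSet_adj]
      refine ⟨?_, hu.ne⟩
      rw [hW, Finset.mem_coe, Finset.mem_filter]
      exact ⟨by simpa using hu, by rw [h]; exact hs⟩
    choose u s hu hus using h1
    have := Finset.card_le_card_of_injOn (s := Finset.univ) (t := Finset.univ.filter (H.Adj v)) u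
      (fun i _ => by simpa using hu i) (by
        intro i _ j _ hij
        have h2 := hus i
        rw [hij, hus j] at h2
        have := hf h2
        simp only [Prod.mk.injEq, Sigma.mk.injEq, heq_eq_eq, true_and] at this
        exact this.1.symm)
    simpa using this
  refine isVertexConnected_of_expansion (G := G) (Sm := Sm) (b := b) (D := D) (s := s) hk hcard hHG
    (fun v hv => by simpa [hm, hv] using hdegH v) (fun v hv => by simpa [hm, hv] using hdegH v)
    hsm1 hsm2 hsparse hD ?_
  intro A A' hd hA hA'
  obtain ⟨e, he, hem⟩ := hc ⟨(A, A'), hd, hA, hA'⟩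
  have he1 := (Finset.mem_sdiff.1 he).1
  have heR := hcutR _ _ he1
  obtain ⟨⟨x, y⟩, hq, rfl⟩ := Finset.mem_image.1 he1
  simp only [Finset.mem_filter, Finset.mem_product] at hq
  refine ⟨x, hq.1.1, y, hq.1.2, ?_⟩
  rw [hH, SimpleGraph.fromEdgeSet_adj]
  refine ⟨?_, hq.2.ne⟩
  rw [hW, Finset.mem_coe, Finset.mem_filter]
  exact ⟨by simpa using hR hq.2, hem⟩

/-! ### Tail bounds and the second moment method for uniformly random orderings -/

section Ordering

set_option linter.unusedSectionVars false

variable {E : Type*} [Fintype E] [DecidableEq E] {N : ℕ}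

/-- The probability of the event `A` for a uniformly random bijection `E ≃ Fin N`. -/
noncomputable def orderingProb (A : Set (E ≃ Fin N)) : ℝ :=
  (A.ncard : ℝ) / (Nat.card (E ≃ Fin N) : ℝ)

theorem orderingProb_eq (A : Set (E ≃ Fin N)) [DecidablePred (· ∈ A)] :
    orderingProb A = ((Finset.univ.filter (· ∈ A)).card : ℝ) / (Fintype.card (E ≃ Fin N) : ℝ) := by
  rw [orderingProb, Nat.card_eq_fintype_card, ← Set.ncard_coe_finset]
  simp

theorem orderingProb_nonneg (A : Set (E ≃ Fin N)) : 0 ≤ orderingProb A := by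
  unfold orderingProb
  positivity

theorem orderingProb_mono {A B : Set (E ≃ Fin N)} (h : A ⊆ B) :
    orderingProb A ≤ orderingProb B := by
  unfold orderingProb
  gcongr
  exact B.toFinite

theorem orderingProb_union_le (A B : Set (E ≃ Fin N)) :
    orderingProb (A ∪ B) ≤ orderingProb A + orderingProb B := by
  unfold orderingProb
  rw [← add_div]
  gcongr
  exact_mod_cast Set.ncard_union_le A B

theorem orderingProb_biUnion_le {ι : Type*} (s : Finset ι) (A : ι → Set (E ≃ Fin N)) :
    orderingProb (⋃ i ∈ s, A i) ≤ ∑ i ∈ s, orderingProb (A i) := by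
  classical
  induction s using Finset.induction_on with
  | empty => simp [orderingProb]
  | insert a s ha ih =>
    rw [Finset.set_biUnion_insert, Finset.sum_insert ha]
    exact (orderingProb_union_le _ _).trans (by gcongr)

theorem one_sub_le_orderingProb_compl [Nonempty (E ≃ Fin N)] (A : Set (E ≃ Fin N)) :
    1 - orderingProb A ≤ orderingProb Aᶜ := by
  have h1 : orderingProb (A ∪ Aᶜ) = 1 := by
    rw [Set.union_compl_self, orderingProb, Set.ncard_univ, div_self]
    exact_mod_cast Nat.card_pos.ne'
  linarith [orderingProb_union_le A Aᶜ]

theorem orderingProb_le_one (A : Set (E ≃ Fin N)) : orderingProb A ≤ 1 := by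
  unfold orderingProb
  refine div_le_one_of_le₀ ?_ (by positivity)
  exact_mod_cast Set.ncard_le_card A

/-- Exposing the position of one more element: if the event `S` depends only on the positions of
the elements of `F`, then the new element is equally likely to be at each of the other
positions. -/
theorem card_filter_mem_mul (hN : Fintype.card E = N) (S : Finset (E ≃ Fin N)) (F : Finset E)
    (hS : ∀ π ∈ S, ∀ π' : E ≃ Fin N, (∀ x ∈ F, π' x = π x) → π' ∈ S) {e : E} (he : e ∉ F)
    (A : Finset (Fin N)) :
    (S.filter fun π => π e ∈ A).card * (N - F.card) = ∑ π ∈ S, (A \ F.image π).card := by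
  -- Swapping two elements outside `F` preserves `S`, so all of them reach `A` equally often. Double
  -- counting over `Fᶜ` then gives the identity.
  have h1 : ∀ e' ∈ Fᶜ, (S.filter fun π => π e' ∈ A).card = (S.filter fun π => π e ∈ A).card := by
    intro e' he'
    rw [Finset.mem_compl] at he'
    have hmem : ∀ π ∈ S, (Equiv.swap e e').trans π ∈ S := by
      intro π hπ
      refine hS π hπ _ fun x hx => ?_
      rw [Equiv.trans_apply, Equiv.swap_apply_of_ne_of_ne]
      · rintro rfl; exact he hx
      · rintro rfl; exact he' hx
    refine Finset.card_bij' (fun π _ => (Equiv.swap e e').trans π)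
      (fun π _ => (Equiv.swap e e').trans π) ?_ ?_ ?_ ?_
    · intro π hπ
      rw [Finset.mem_filter] at hπ ⊢
      exact ⟨hmem π hπ.1, by simpa using hπ.2⟩
    · intro π hπ
      rw [Finset.mem_filter] at hπ ⊢
      exact ⟨hmem π hπ.1, by simpa using hπ.2⟩
    · intro π _
      ext x
      simp
    · intro π _
      ext x
      simp
  calc (S.filter fun π => π e ∈ A).card * (N - F.card)
      = ∑ e' ∈ Fᶜ, (S.filter fun π => π e' ∈ A).card := by
        rw [Finset.sum_congr rfl h1, Finset.sum_const, Finset.card_compl, hN, smul_eq_mul, mul_comm]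
    _ = ∑ π ∈ S, (Fᶜ.filter fun e' => π e' ∈ A).card :=
        Finset.sum_card_bipartiteAbove_eq_sum_card_bipartiteBelow
          (r := fun (e' : E) (π : E ≃ Fin N) => π e' ∈ A)
    _ = ∑ π ∈ S, (A \ F.image π).card := by
        refine Finset.sum_congr rfl fun π _ => ?_
        rw [← Finset.card_image_of_injective (Fᶜ.filter fun e' => π e' ∈ A) π.injective]
        congr 1
        ext a
        simp only [Finset.mem_image, Finset.mem_filter, Finset.mem_compl, Finset.mem_sdiff]
        constructor
        · rintro ⟨x, ⟨hx, hxA⟩, rfl⟩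
          exact ⟨hxA, fun ⟨y, hy, hyx⟩ => hx (π.injective hyx ▸ hy)⟩
        · rintro ⟨ha, hx⟩
          exact ⟨π.symm a, ⟨fun h => hx ⟨_, h, by simp⟩, by simpa using ha⟩, by simp⟩

/-- The orderings which map `F` into `A`. -/
def mapsInto (F : Finset E) (A : Finset (Fin N)) : Set (E ≃ Fin N) := {π | ∀ x ∈ F, π x ∈ A}

theorem mem_mapsInto {F : Finset E} {A : Finset (Fin N)} {π : E ≃ Fin N} :
    π ∈ mapsInto F A ↔ ∀ x ∈ F, π x ∈ A := Iff.rfl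

/-- Expose the elements of `F` one at a time: after `i` of them have landed in `A`, the next has
`|A| - i` good positions among `N - i`. -/
theorem orderingProb_mapsInto [Nonempty (E ≃ Fin N)] (F : Finset E) (A : Finset (Fin N)) :
    orderingProb (mapsInto F A) =
      ∏ i ∈ Finset.range F.card, ((A.card : ℝ) - i) / ((N : ℝ) - i) := by
  classical
  have hN : Fintype.card E = N := by
    obtain ⟨π⟩ := ‹Nonempty (E ≃ Fin N)›
    simpa using Fintype.card_congr π
  have hpos : (0 : ℝ) < Fintype.card (E ≃ Fin N) := by exact_mod_cast Fintype.card_pos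
  induction F using Finset.induction_on with
  | empty =>
    rw [orderingProb_eq]
    simp [mapsInto, hpos.ne']
  | insert e F he ih =>
    rw [Finset.card_insert_of_notMem he, Finset.prod_range_succ, ← ih]
    have h1 := card_filter_mem_mul hN (Finset.univ.filter (· ∈ mapsInto F A)) F (by
      intro π hπ π' h
      rw [Finset.mem_filter, mem_mapsInto] at hπ ⊢
      exact ⟨Finset.mem_univ _, fun x hx => by rw [h x hx]; exact hπ.2 x hx⟩) he A
    have h2 : (Finset.univ.filter (· ∈ mapsInto F A)).filter (fun π : E ≃ Fin N => π e ∈ A) =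
        Finset.univ.filter (· ∈ mapsInto (insert e F) A) := by
      ext π
      simp only [Finset.mem_filter, Finset.mem_univ, true_and, mem_mapsInto,
        Finset.forall_mem_insert]
      tauto
    have hFN : F.card + 1 ≤ N := by
      rw [← hN, ← Finset.card_insert_of_notMem he]
      exact Finset.card_le_univ _
    have hFN' : (0 : ℝ) < (N : ℝ) - F.card := by
      have : (F.card : ℝ) + 1 ≤ N := by exact_mod_cast hFN
      linarith
    have h3 : ∀ π ∈ Finset.univ.filter (· ∈ mapsInto F A),
        (((A \ F.image π).card : ℕ) : ℝ) = (A.card : ℝ) - F.card := by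
      intro π hπ
      have hsub : F.image π ⊆ A := by
        rw [Finset.mem_filter, mem_mapsInto] at hπ
        intro a ha
        obtain ⟨x, hx, rfl⟩ := Finset.mem_image.1 ha
        exact hπ.2 x hx
      rw [Finset.cast_card_sdiff hsub, Finset.card_image_of_injective _ π.injective]
    have h4 : ((Finset.univ.filter (· ∈ mapsInto (insert e F) A)).card : ℝ) * ((N : ℝ) - F.card) =
        (Finset.univ.filter (· ∈ mapsInto F A)).card * ((A.card : ℝ) - F.card) := by
      rw [← h2, ← nsmul_eq_mul ((Finset.univ.filter (· ∈ mapsInto F A)).card), ← Finset.sum_const,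
        ← Finset.sum_congr rfl h3, ← Nat.cast_sub (by omega : F.card ≤ N)]
      exact_mod_cast h1
    rw [orderingProb_eq, orderingProb_eq]
    field_simp
    linarith

/-- The factors behave as for independent choices, up to the positions already used by `F`. Nothing
is assumed about the overlap of `A` and `B`, so in the worst case no element of `F` occupies a
position of `B`; this is why the second denominator is `N - |F|`. -/
theorem orderingProb_mapsInto_inter_le [Nonempty (E ≃ Fin N)] {F D : Finset E}
    {A B : Finset (Fin N)} (hFD : Disjoint F D) (hB : B.card + F.card ≤ N) :
    orderingProb (mapsInto F A ∩ mapsInto D B) ≤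
      ((A.card : ℝ) / N) ^ F.card * ((B.card : ℝ) / ((N : ℝ) - F.card)) ^ D.card := by
  classical
  have hN : Fintype.card E = N := by
    obtain ⟨π⟩ := ‹Nonempty (E ≃ Fin N)›
    simpa using Fintype.card_congr π
  have hpos : (0 : ℝ) < Fintype.card (E ≃ Fin N) := by exact_mod_cast Fintype.card_pos
  have hAN : (A.card : ℝ) ≤ N := by exact_mod_cast card_finset_fin_le A
  induction D using Finset.induction_on with
  | empty =>
    rw [Finset.card_empty, pow_zero, mul_one]
    refine (orderingProb_mono Set.inter_subset_left).trans ?_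
    rw [orderingProb_mapsInto]
    by_cases hFA : F.card ≤ A.card
    · rw [← Finset.card_range F.card, ← Finset.prod_const, Finset.card_range]
      refine Finset.prod_le_prod (fun i hi => ?_) (fun i hi => ?_)
      all_goals
        have hi : (i : ℝ) + 1 ≤ F.card := by exact_mod_cast Finset.mem_range.1 hi
        have hF : (F.card : ℝ) ≤ A.card := by exact_mod_cast hFA
      · exact div_nonneg (by linarith) (by linarith)
      · have : (0 : ℝ) ≤ i := by positivity
        rw [div_le_div_iff₀ (by linarith) (by linarith)]
        nlinarith
    · rw [Finset.prod_eq_zero (i := A.card) (by simpa using hFA) (by simp)]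
      positivity
  | insert e D he ih =>
    rw [Finset.disjoint_insert_right] at hFD
    have ih := ih hFD.2
    set S := Finset.univ.filter (· ∈ mapsInto F A ∩ mapsInto D B) with hS
    have heFD : e ∉ F ∪ D := by simp [he, hFD.1]
    have h1 := card_filter_mem_mul hN S (F ∪ D) (by
      intro π hπ π' h
      simp only [hS, mem_mapsInto, Set.mem_inter_iff, Finset.mem_filter,
        Finset.mem_univ, true_and] at hπ ⊢
      exact ⟨fun x hx => by rw [h x (Finset.mem_union_left _ hx)]; exact hπ.1 x hx,
        fun x hx => by rw [h x (Finset.mem_union_right _ hx)]; exact hπ.2 x hx⟩) heFD B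
    have h2 : S.filter (fun π : E ≃ Fin N => π e ∈ B) =
        Finset.univ.filter (· ∈ mapsInto F A ∩ mapsInto (insert e D) B) := by
      ext π
      simp only [hS, mem_mapsInto, Set.mem_inter_iff, Finset.mem_filter,
        Finset.mem_univ, true_and, Finset.forall_mem_insert]
      tauto
    have hc : (F ∪ D).card = F.card + D.card := Finset.card_union_of_disjoint hFD.2
    have hFN : F.card + D.card + 1 ≤ N := by
      rw [← hN, ← hc, ← Finset.card_insert_of_notMem heFD]
      exact Finset.card_le_univ _
    have hFN' : (F.card : ℝ) + D.card + 1 ≤ N := by exact_mod_cast hFN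
    have hD0 : (0 : ℝ) ≤ D.card := by positivity
    have hB' : (B.card : ℝ) + F.card ≤ N := by exact_mod_cast hB
    -- Only the images of `D` are sure to occupy positions of `B`. The resulting ratio `(|B| - |D|)
    -- / (N - |F| - |D|)` is at most `|B| / (N - |F|)` because `|B| ≤ N - |F|`.
    have h3 : ∀ π ∈ S, (((B \ (F ∪ D).image π).card : ℕ) : ℝ) ≤ (B.card : ℝ) - D.card := by
      intro π hπ
      have hsub : D.image π ⊆ B := by
        simp only [hS, mem_mapsInto, Set.mem_inter_iff, Finset.mem_filter,
          Finset.mem_univ, true_and] at hπ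
        intro a ha
        obtain ⟨x, hx, rfl⟩ := Finset.mem_image.1 ha
        exact hπ.2 x hx
      rw [← Finset.card_image_of_injective D π.injective, ← Finset.cast_card_sdiff hsub]
      exact_mod_cast Finset.card_le_card
        (Finset.sdiff_subset_sdiff le_rfl (Finset.image_subset_image Finset.subset_union_right))
    have h4 : ((Finset.univ.filter (· ∈ mapsInto F A ∩ mapsInto (insert e D) B)).card : ℝ) *
        ((N : ℝ) - F.card - D.card) ≤ S.card * ((B.card : ℝ) - D.card) := by
      have h5 : ((S.filter fun π => π e ∈ B).card : ℝ) * ((N : ℝ) - F.card - D.card) =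
          ∑ π ∈ S, (((B \ (F ∪ D).image π).card : ℕ) : ℝ) := by
        rw [hc] at h1
        have : ((N - (F.card + D.card) : ℕ) : ℝ) = (N : ℝ) - F.card - D.card := by
          rw [Nat.cast_sub (by omega)]
          push_cast
          ring
        rw [← this]
        exact_mod_cast h1
      rw [← h2, h5, ← nsmul_eq_mul, ← Finset.sum_const]
      exact Finset.sum_le_sum h3
    rw [Finset.card_insert_of_notMem he, pow_succ, ← mul_assoc]
    have h6 : orderingProb (mapsInto F A ∩ mapsInto (insert e D) B) ≤
        orderingProb (mapsInto F A ∩ mapsInto D B) * (B.card / ((N : ℝ) - F.card)) := by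
      rw [orderingProb_eq, orderingProb_eq, ← hS, div_mul_div_comm,
        div_le_div_iff₀ hpos (mul_pos hpos (by linarith))]
      set c := ((Finset.univ.filter (· ∈ mapsInto F A ∩ mapsInto (insert e D) B)).card : ℝ)
      have h7 : c * ((N : ℝ) - F.card) ≤ S.card * B.card := by
        have hx : 0 < (N : ℝ) - F.card - D.card := by linarith
        have hS0 : (0 : ℝ) ≤ S.card := by positivity
        refine le_of_mul_le_mul_right ?_ hx
        calc c * ((N : ℝ) - F.card) * ((N : ℝ) - F.card - D.card)
            = (c * ((N : ℝ) - F.card - D.card)) * ((N : ℝ) - F.card) := by ring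
          _ ≤ (S.card * ((B.card : ℝ) - D.card)) * ((N : ℝ) - F.card) := by
              gcongr
              linarith
          _ = S.card * (((B.card : ℝ) - D.card) * ((N : ℝ) - F.card)) := by ring
          _ ≤ S.card * (B.card * ((N : ℝ) - F.card - D.card)) := by
              refine mul_le_mul_of_nonneg_left ?_ hS0
              nlinarith [mul_nonneg hD0 (sub_nonneg.2 hB')]
          _ = _ := by ring
      nlinarith
    refine h6.trans ?_
    gcongr
    exact div_nonneg (by positivity) (by linarith)

open Classical in
/-- An upper tail bound by exponential moments. -/
theorem orderingProb_upper_tail_inter [Nonempty (E ≃ Fin N)] {X D : Finset E}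
    {A B : Finset (Fin N)} (hXD : Disjoint X D) (hB : B.card + X.card ≤ N) (hX : X.card < N)
    {θ : ℝ} (hθ : 1 ≤ θ) (m : ℕ) :
    orderingProb ({π | m ≤ (X.filter fun x => π x ∈ A).card} ∩ mapsInto D B) * θ ^ m ≤
      (1 + (θ - 1) * ((A.card : ℝ) / N)) ^ X.card *
        ((B.card : ℝ) / ((N : ℝ) - X.card)) ^ D.card := by
  have hpos : (0 : ℝ) < Fintype.card (E ≃ Fin N) := by exact_mod_cast Fintype.card_pos
  have hX' : (X.card : ℝ) < N := by exact_mod_cast hX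
  set S : Finset (E ≃ Fin N) := Finset.univ.filter (· ∈ mapsInto D B) with hS
  have h1 : ((Finset.univ.filter
      (· ∈ {π : E ≃ Fin N | m ≤ (X.filter fun x => π x ∈ A).card} ∩ mapsInto D B)).card : ℝ) *
        θ ^ m ≤ ∑ π ∈ S, θ ^ (X.filter fun x => π x ∈ A).card := by
    rw [← nsmul_eq_mul, ← Finset.sum_const]
    refine (Finset.sum_le_sum (g := fun π : E ≃ Fin N => θ ^ (X.filter fun x => π x ∈ A).card)
      fun π hπ => ?_).trans (Finset.sum_le_sum_of_subset_of_nonneg ?_ fun π _ _ => by positivity)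
    · exact pow_le_pow_right₀ hθ (Finset.mem_filter.1 hπ).2.1
    · intro π hπ
      exact Finset.mem_filter.2 ⟨Finset.mem_univ _, (Finset.mem_filter.1 hπ).2.2⟩
  -- Binomial expansion of `((θ - 1) + 1) ^ j` over subsets of the elements placed in `A`. It
  -- reduces the exponential moment to the probabilities of `mapsInto F A`; summing these bounds
  -- over `F ⊆ X` gives back a binomial power.
  have h2 : ∀ π : E ≃ Fin N, θ ^ (X.filter fun x => π x ∈ A).card =
      ∑ F ∈ X.powerset, if π ∈ mapsInto F A then (θ - 1) ^ F.card else 0 := by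
    intro π
    have h3 : X.powerset.filter (fun F => π ∈ mapsInto F A) =
        (X.filter fun x => π x ∈ A).powerset := by
      ext F
      simp only [Finset.mem_filter, Finset.mem_powerset, mem_mapsInto, Finset.subset_iff]
      exact ⟨fun h x hx => ⟨h.1 hx, h.2 x hx⟩, fun h => ⟨fun x hx => (h hx).1, fun x hx => (h hx).2⟩⟩
    rw [← Finset.sum_filter, h3]
    have := Finset.sum_pow_mul_eq_add_pow (θ - 1) 1 (X.filter fun x => π x ∈ A)
    simp only [one_pow, mul_one, sub_add_cancel] at this
    exact this.symm
  have h3 : ∑ π ∈ S, θ ^ (X.filter fun x => π x ∈ A).card =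
      ∑ F ∈ X.powerset, (θ - 1) ^ F.card *
        (orderingProb (mapsInto F A ∩ mapsInto D B) * Fintype.card (E ≃ Fin N)) := by
    rw [Finset.sum_congr rfl fun π _ => h2 π, Finset.sum_comm]
    refine Finset.sum_congr rfl fun F _ => ?_
    rw [← Finset.sum_filter, Finset.sum_const, nsmul_eq_mul, mul_comm, orderingProb_eq,
      div_mul_cancel₀ _ hpos.ne', hS, Finset.filter_filter]
    congr 3
    ext π
    simp [and_comm]
  have h4 : ∑ F ∈ X.powerset, (θ - 1) ^ F.card *
        (orderingProb (mapsInto F A ∩ mapsInto D B) * Fintype.card (E ≃ Fin N)) ≤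
      ((1 + (θ - 1) * ((A.card : ℝ) / N)) ^ X.card *
        ((B.card : ℝ) / ((N : ℝ) - X.card)) ^ D.card) * Fintype.card (E ≃ Fin N) := by
    have h5 := Finset.sum_pow_mul_eq_add_pow ((θ - 1) * ((A.card : ℝ) / N)) 1 X
    simp only [one_pow, mul_one] at h5
    rw [add_comm (1 : ℝ), ← h5, Finset.sum_mul, Finset.sum_mul]
    refine Finset.sum_le_sum fun F hF => ?_
    rw [Finset.mem_powerset] at hF
    have hFX := Finset.card_le_card hF
    have hFX' : (F.card : ℝ) ≤ X.card := by exact_mod_cast hFX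
    have h6 := orderingProb_mapsInto_inter_le (A := A) (B := B)
      (Finset.disjoint_of_subset_left hF hXD) (by omega)
    have hθ' : 0 ≤ θ - 1 := by linarith
    have hNX : 0 < (N : ℝ) - X.card := by linarith
    have h7 : orderingProb (mapsInto F A ∩ mapsInto D B) ≤
        ((A.card : ℝ) / N) ^ F.card * ((B.card : ℝ) / ((N : ℝ) - X.card)) ^ D.card := by
      refine h6.trans ?_
      gcongr
      exact div_nonneg (by positivity) (by linarith)
    refine (mul_le_mul_of_nonneg_left (mul_le_mul_of_nonneg_right h7 hpos.le)
      (pow_nonneg hθ' _)).trans (le_of_eq ?_)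
    rw [mul_pow]
    ring
  rw [orderingProb_eq, div_mul_eq_mul_div, div_le_iff₀ hpos]
  exact h1.trans (h3.le.trans h4)

open Classical in
theorem orderingProb_upper_tail [Nonempty (E ≃ Fin N)] (X : Finset E) (A : Finset (Fin N))
    (hX : X.card < N) {θ : ℝ} (hθ : 1 ≤ θ) (m : ℕ) :
    orderingProb {π : E ≃ Fin N | m ≤ (X.filter fun x => π x ∈ A).card} * θ ^ m ≤
      Real.exp (θ * ((A.card : ℝ) / N) * X.card) := by
  have h := orderingProb_upper_tail_inter (D := ∅) (A := A) (B := ∅)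
    (Finset.disjoint_empty_right X) (by simpa using hX.le) hX hθ m
  have h0 : (mapsInto ∅ ∅ : Set (E ≃ Fin N)) = Set.univ := by ext; simp [mapsInto]
  rw [h0, Set.inter_univ, Finset.card_empty (α := E), pow_zero, mul_one] at h
  refine h.trans ?_
  have hp : (0 : ℝ) ≤ (A.card : ℝ) / N := by positivity
  have h1 : 1 + (θ - 1) * ((A.card : ℝ) / N) ≤ Real.exp (θ * ((A.card : ℝ) / N)) := by
    have := Real.add_one_le_exp (θ * ((A.card : ℝ) / N))
    nlinarith
  rw [mul_comm _ (X.card : ℝ), Real.exp_nat_mul]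
  exact pow_le_pow_left₀ (by nlinarith) h1 _

open Classical in
-- Few elements in `A` means many in the complement, so the upper tail applies to `Aᶜ` with `θ = K`.
-- The factor `K ^ |X|` cancels because `1 + (K - 1) (1 - p) = K (1 - (1 - 1 / K) p)`. A large `K`
-- brings the rate close to `1`, at the cost `K ^ m`.
theorem orderingProb_lower_tail_inter [Nonempty (E ≃ Fin N)] {X D : Finset E}
    {A B : Finset (Fin N)} (hXD : Disjoint X D) (hB : B.card + X.card ≤ N) (hX : X.card < N)
    {K : ℝ} (hK : 1 ≤ K) (m : ℕ) :
    orderingProb ({π | (X.filter fun x => π x ∈ A).card ≤ m} ∩ mapsInto D B) ≤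
      K ^ m * Real.exp (-((1 - 1 / K) * ((A.card : ℝ) / N) * X.card)) *
        ((B.card : ℝ) / ((N : ℝ) - X.card)) ^ D.card := by
  have hK0 : 0 < K := by linarith
  have hN : (0 : ℝ) < N := by exact_mod_cast (Nat.zero_le _).trans_lt hX
  have h := orderingProb_upper_tail_inter (A := Aᶜ) hXD hB hX hK (X.card - m)
  set r := ((B.card : ℝ) / ((N : ℝ) - X.card)) ^ D.card with hr
  have hr0 : 0 ≤ r := by
    have : (X.card : ℝ) < N := by exact_mod_cast hX
    have : 0 < (N : ℝ) - X.card := by linarith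
    positivity
  have hmono : orderingProb ({π : E ≃ Fin N | (X.filter fun x => π x ∈ A).card ≤ m} ∩ mapsInto D B) ≤
      orderingProb ({π : E ≃ Fin N | X.card - m ≤ (X.filter fun x => π x ∈ Aᶜ).card} ∩
        mapsInto D B) := by
    refine orderingProb_mono (Set.inter_subset_inter_left _ fun π hπ => ?_)
    have h1 := Finset.card_filter_add_card_filter_not (s := X) (fun x => π x ∈ A)
    simp only [Set.mem_ofPred_eq, Finset.mem_compl] at hπ ⊢
    omega
  set P := orderingProb ({π : E ≃ Fin N | X.card - m ≤ (X.filter fun x => π x ∈ Aᶜ).card} ∩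
        mapsInto D B)
  have hP : 0 ≤ P := orderingProb_nonneg _
  have hAc : ((Aᶜ.card : ℕ) : ℝ) / N = 1 - A.card / N := by
    rw [Finset.card_compl, Fintype.card_fin, Nat.cast_sub (card_finset_fin_le A), sub_div,
      div_self hN.ne']
  rw [hAc] at h
  set p := (A.card : ℝ) / N
  have hp1 : p ≤ 1 := div_le_one_of_le₀ (by exact_mod_cast card_finset_fin_le A) hN.le
  have hp0 : 0 ≤ p := by positivity
  refine hmono.trans ?_
  have h2 : P * K ^ X.card ≤ K ^ m * ((1 + (K - 1) * (1 - p)) ^ X.card * r) := by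
    calc P * K ^ X.card ≤ P * K ^ (m + (X.card - m)) := by
          gcongr
          omega
      _ = K ^ m * (P * K ^ (X.card - m)) := by rw [pow_add]; ring
      _ ≤ _ := by gcongr
  have h3 : (1 + (K - 1) * (1 - p)) ^ X.card ≤
      K ^ X.card * Real.exp (-((1 - 1 / K) * p * X.card)) := by
    have h4 : 1 + (K - 1) * (1 - p) = K * (1 - (1 - 1 / K) * p) := by
      field_simp
      ring
    have h5 : 1 - (1 - 1 / K) * p ≤ Real.exp (-((1 - 1 / K) * p)) := by
      have := Real.add_one_le_exp (-((1 - 1 / K) * p))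
      linarith
    have h6 : 0 ≤ 1 - (1 - 1 / K) * p := by
      have : 0 < 1 / K := by positivity
      have : 1 / K ≤ 1 := by rw [div_le_one hK0]; exact hK
      nlinarith
    rw [h4, mul_pow, show -((1 - 1 / K) * p * X.card) = X.card * -((1 - 1 / K) * p) by ring,
      Real.exp_nat_mul]
    gcongr
  refine le_of_mul_le_mul_right (h2.trans ?_) (pow_pos hK0 X.card)
  calc K ^ m * ((1 + (K - 1) * (1 - p)) ^ X.card * r)
      ≤ K ^ m * ((K ^ X.card * Real.exp (-((1 - 1 / K) * p * X.card))) * r) := by gcongr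
    _ = _ := by ring

open Classical in
theorem orderingProb_lower_tail [Nonempty (E ≃ Fin N)] (X : Finset E) (A : Finset (Fin N))
    (hX : X.card < N) {K : ℝ} (hK : 1 ≤ K) (m : ℕ) :
    orderingProb {π : E ≃ Fin N | (X.filter fun x => π x ∈ A).card ≤ m} ≤
      K ^ m * Real.exp (-((1 - 1 / K) * ((A.card : ℝ) / N) * X.card)) := by
  have h := orderingProb_lower_tail_inter (D := ∅) (A := A) (B := ∅)
    (Finset.disjoint_empty_right X) (by simpa using hX.le) hX hK m
  have h0 : (mapsInto ∅ ∅ : Set (E ≃ Fin N)) = Set.univ := by ext; simp [mapsInto]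
  rwa [h0, Set.inter_univ, Finset.card_empty (α := E), pow_zero, mul_one] at h

/-- The second moment method: for events `I v`, all of probability `q`, such that any two occur
together with probability at most `q ^ 2 / g`. -/
theorem orderingProb_none_le {V : Type*} [Fintype V] [DecidableEq V] [Nonempty (E ≃ Fin N)]
    (I : V → Set (E ≃ Fin N)) {q g : ℝ} (hq : 0 < q) (hg : 0 < g) (hV : 0 < Fintype.card V)
    (h1 : ∀ v, orderingProb (I v) = q)
    (h2 : ∀ u v, u ≠ v → orderingProb (I u ∩ I v) ≤ q ^ 2 / g) :
    orderingProb {π | ∀ v, π ∉ I v} ≤ 1 / (Fintype.card V * q) + (1 / g - 1) := by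
  classical
  have hpos : (0 : ℝ) < Fintype.card (E ≃ Fin N) := by exact_mod_cast Fintype.card_pos
  set T : ℝ := (Fintype.card (E ≃ Fin N) : ℝ) with hT
  set c : ℝ := (Fintype.card V : ℝ) with hc
  have hc0 : 0 < c := Nat.cast_pos.2 hV
  set ind : V → (E ≃ Fin N) → ℝ := fun v π => if π ∈ I v then 1 else 0 with hind
  have hs1 : ∀ v, ∑ π, ind v π = q * T := by
    intro v
    rw [← h1 v, orderingProb_eq, div_mul_cancel₀ _ hpos.ne']
    simp [hind]
  have hs2 : ∀ u v, ∑ π, ind u π * ind v π = orderingProb (I u ∩ I v) * T := by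
    intro u v
    rw [orderingProb_eq, div_mul_cancel₀ _ hpos.ne']
    simp only [hind, ← ite_and, mul_ite, mul_one, mul_zero]
    rw [← Finset.sum_filter, Finset.sum_const, nsmul_eq_mul, mul_one]
    congr 3
    ext π
    simp [and_comm]
  set Y : (E ≃ Fin N) → ℝ := fun π => ∑ v, ind v π with hY
  have hsY : ∑ π, Y π = c * (q * T) := by
    rw [Finset.sum_comm, Finset.sum_congr rfl fun v _ => hs1 v]
    simp [hc]
  have hsY2 : ∑ π, Y π ^ 2 ≤ (c * q + c ^ 2 * (q ^ 2 / g)) * T := by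
    have : ∀ π, Y π ^ 2 = ∑ u, ∑ v, ind u π * ind v π := fun π => by
      rw [sq, hY, Finset.sum_mul_sum]
    simp only [this]
    rw [Finset.sum_comm]
    have h3 : ∀ u : V, ∑ π, ∑ v, ind u π * ind v π ≤ (q + c * (q ^ 2 / g)) * T := by
      intro u
      rw [Finset.sum_comm]
      simp only [hs2]
      rw [← Finset.sum_mul]
      gcongr
      rw [← Finset.add_sum_erase _ _ (Finset.mem_univ u), Set.inter_self, h1]
      gcongr
      calc ∑ v ∈ Finset.univ.erase u, orderingProb (I u ∩ I v)
          ≤ ∑ v ∈ Finset.univ.erase u, q ^ 2 / g :=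
            Finset.sum_le_sum fun v hv => h2 u v (Finset.ne_of_mem_erase hv).symm
        _ = ((Finset.univ.erase u).card : ℝ) * (q ^ 2 / g) := by
            rw [Finset.sum_const, nsmul_eq_mul]
        _ ≤ c * (q ^ 2 / g) := by
            gcongr
            rw [hc]
            exact_mod_cast Finset.card_le_univ _
    refine (Finset.sum_le_sum fun u _ => h3 u).trans (le_of_eq ?_)
    rw [Finset.sum_const, nsmul_eq_mul, Finset.card_univ]
    ring
  -- Chebyshev's inequality for the number `Y` of events that occur, whose mean is `c * q`: every
  -- ordering without such an event contributes `(c * q) ^ 2` to the variance sum.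
  have hvar : ∑ π, (Y π - c * q) ^ 2 = ∑ π, Y π ^ 2 - (c * q) ^ 2 * T := by
    have : ∀ π, (Y π - c * q) ^ 2 = Y π ^ 2 - 2 * (c * q) * Y π + (c * q) ^ 2 := fun π => by ring
    simp only [this]
    rw [Finset.sum_add_distrib, Finset.sum_sub_distrib, ← Finset.mul_sum, hsY, Finset.sum_const,
      nsmul_eq_mul, Finset.card_univ]
    ring
  have hlow : (c * q) ^ 2 * (orderingProb {π | ∀ v, π ∉ I v} * T) ≤
      ∑ π, (Y π - c * q) ^ 2 := by
    rw [orderingProb_eq, div_mul_cancel₀ _ hpos.ne', mul_comm, ← nsmul_eq_mul, ← Finset.sum_const]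
    refine (Finset.sum_le_sum (g := fun π => (Y π - c * q) ^ 2) fun π hπ => le_of_eq ?_).trans
      (Finset.sum_le_sum_of_subset_of_nonneg (Finset.subset_univ _) fun π _ _ => by positivity)
    have : Y π = 0 := Finset.sum_eq_zero fun v _ => by
      simp [hind, (Finset.mem_filter.1 hπ).2 v]
    rw [this]
    ring
  set P := orderingProb {π : E ≃ Fin N | ∀ v, π ∉ I v}
  have h5 : (c * q) ^ 2 * P * T ≤ (c * q + c ^ 2 * (q ^ 2 / g) - (c * q) ^ 2) * T := by
    linarith
  have h6 := le_of_mul_le_mul_right h5 hpos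
  have h7 : (c * q) ^ 2 * (1 / (c * q) + (1 / g - 1)) =
      c * q + c ^ 2 * (q ^ 2 / g) - (c * q) ^ 2 := by
    field_simp
    ring
  rw [← h7] at h6
  exact le_of_mul_le_mul_left h6 (by positivity)

end Ordering

/-! ### The graph process: graphs of position ranges and counts of pairs -/

section ProcessGraphs

variable {n : ℕ}

/-- The graph formed by the pairs whose position is in `A`. -/
def positionGraph (π : EdgeOrdering n) (A : Finset (Fin (n.choose 2))) : SimpleGraph (Fin n) :=
  SimpleGraph.fromEdgeSet {e | ∃ h : ¬ e.IsDiag, π ⟨e, h⟩ ∈ A}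

theorem positionGraph_adj {π : EdgeOrdering n} {A : Finset (Fin (n.choose 2))} {u v : Fin n} :
    (positionGraph π A).Adj u v ↔ ∃ h : ¬ s(u, v).IsDiag, π ⟨s(u, v), h⟩ ∈ A := by
  rw [positionGraph, SimpleGraph.fromEdgeSet_adj]
  constructor
  · exact fun h => h.1
  · exact fun ⟨h, hA⟩ => ⟨⟨h, hA⟩, by simpa using h⟩

theorem positionGraph_mono (π : EdgeOrdering n) {A B : Finset (Fin (n.choose 2))} (h : A ⊆ B) :
    positionGraph π A ≤ positionGraph π B := by
  intro u v
  rw [positionGraph_adj, positionGraph_adj]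
  exact fun ⟨h1, h2⟩ => ⟨h1, h h2⟩

theorem disjoint_positionGraph (π : EdgeOrdering n) {A B : Finset (Fin (n.choose 2))}
    (h : Disjoint A B) : Disjoint (positionGraph π A) (positionGraph π B) := by
  rw [SimpleGraph.disjoint_left]
  intro u v
  rw [positionGraph_adj, positionGraph_adj]
  exact fun ⟨h1, h2⟩ ⟨_, h3⟩ => Finset.disjoint_left.1 h h2 h3

/-- The positions in `[a, b)`. -/
def positions (N a b : ℕ) : Finset (Fin N) := Finset.univ.filter fun i => a ≤ i ∧ (i : ℕ) < b

theorem mem_positions {N a b : ℕ} {i : Fin N} : i ∈ positions N a b ↔ a ≤ i ∧ (i : ℕ) < b := by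
  simp [positions]

theorem card_positions {N a b : ℕ} (hb : b ≤ N) : (positions N a b).card = b - a := by
  rw [← Finset.card_map Fin.valEmbedding, ← Nat.card_Ico]
  congr 1
  ext i
  simp only [Finset.mem_map, mem_positions, Finset.mem_Ico, Fin.valEmbedding_apply]
  exact ⟨fun ⟨j, hj, e⟩ => e ▸ hj, fun h => ⟨⟨i, h.2.trans_le hb⟩, h, rfl⟩⟩

theorem positions_subset {N a b c d : ℕ} (hac : c ≤ a) (hbd : b ≤ d) :
    positions N a b ⊆ positions N c d := by
  intro i
  simp only [mem_positions]
  omega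

theorem graphProcess_eq (π : EdgeOrdering n) (t : ℕ) :
    graphProcess π t = positionGraph π (positions _ 0 t) := by
  simp [graphProcess, positionGraph, mem_positions]

theorem graphProcess_mono (π : EdgeOrdering n) {t t' : ℕ} (h : t ≤ t') :
    graphProcess π t ≤ graphProcess π t' := by
  rw [graphProcess_eq, graphProcess_eq]
  exact positionGraph_mono π (positions_subset le_rfl h)

open Classical in
/-- The vertices of degree at most `d` in the graph formed by the positions in `[a, b)`. -/
noncomputable def smallVertices (π : EdgeOrdering n) (a b d : ℕ) : Finset (Fin n) :=
  Finset.univ.filter fun v =>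
    (Finset.univ.filter ((positionGraph π (positions _ a b)).Adj v)).card ≤ d

open Classical in
-- Passage from three fixed times to the hitting time. Cuts are measured in the smallest graph,
-- sparseness and distances between small vertices in the largest, and small vertices by the edges
-- in `[r, t₀)`. The only input taken at the hitting time itself is the minimum degree `2k`, used at
-- the small vertices.
theorem hittingTime_eq_of_pseudorandom {π : EdgeOrdering n} {k b D s r t₀ t₁ : ℕ} (hk : 1 ≤ k)
    (hkn : k < n) (hr : r ≤ t₀) (ht₁ : t₁ ≤ n.choose 2)
    (hiso : ∃ v, ∀ u, ¬ (graphProcess π t₀).Adj v u)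
    (hdeg : ∀ v, 2 * k ≤ (Finset.univ.filter ((graphProcess π t₁).Adj v)).card)
    (hsm1 : ∀ u ∈ smallVertices π r t₀ (4 * D), ∀ v ∈ smallVertices π r t₀ (4 * D), u ≠ v →
      ¬ (graphProcess π t₁).Adj u v)
    (hsm2 : ∀ u ∈ smallVertices π r t₀ (4 * D), ∀ v ∈ smallVertices π r t₀ (4 * D), u ≠ v →
      ∀ w, (graphProcess π t₁).Adj u w → ¬ (graphProcess π t₁).Adj v w)
    (hsparse : ∀ T : Finset (Fin n), T.Nonempty → T.card ≤ s →
      ((T ×ˢ T).filter fun p => (graphProcess π t₁).Adj p.1 p.2).card < 2 * b * T.card)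
    (hD : 2 * b * k + 1 ≤ D)
    (hcut : ∀ A A' : Finset (Fin n), Disjoint A A' → s < A.card + k → s < A'.card + k →
      2 * (k + 1) * n + 2 ≤ ((A ×ˢ A').filter fun p => (graphProcess π r).Adj p.1 p.2).card) :
    hittingTime π (MakerBreaker.MakerWinsGame (IsVertexConnected k)) =
        hittingTime π (HasMinDegreeAtLeast (2 * k)) ∧
      hittingTime π (HasMinDegreeAtLeast (2 * k)) ≠ ⊤ := by
  have : Nonempty (Fin n) := ⟨⟨0, by omega⟩⟩
  have hex : ∃ t, t ≤ n.choose 2 ∧ HasMinDegreeAtLeast (2 * k) (graphProcess π t) :=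
    ⟨t₁, ht₁, (hasMinDegreeAtLeast_iff _ _).2 hdeg⟩
  obtain ⟨hτN, hτ⟩ := Nat.find_spec hex
  have hτ₁ : Nat.find hex ≤ t₁ := Nat.find_min' hex ⟨ht₁, (hasMinDegreeAtLeast_iff _ _).2 hdeg⟩
  set τ := Nat.find hex with hτdef
  have hτ' := (hasMinDegreeAtLeast_iff _ _).1 hτ
  -- A vertex isolated at `t₀` was isolated before, so degree `2k ≥ 2` is not reached earlier.
  have hτ₀ : t₀ ≤ τ := by
    by_contra! hlt
    obtain ⟨v, hv⟩ := hiso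
    have h1 := hτ' v
    rw [Finset.filter_false_of_mem, Finset.card_empty] at h1
    · omega
    · exact fun u _ h => hv u (graphProcess_mono π hlt.le h)
  have hG₁ := graphProcess_mono π hτ₁
  have hwin : MakerBreaker.MakerWinsGame (IsVertexConnected k) (graphProcess π τ) := by
    refine makerWinsGame_isVertexConnected (R := graphProcess π r)
      (B := positionGraph π (positions _ r t₀)) (Sm := smallVertices π r t₀ (4 * D)) (b := b)
      (D := D) (s := s) hk (by simpa using hkn) (graphProcess_mono π (hr.trans hτ₀)) ?_ ?_ hτ' ?_
      ?_ ?_ ?_ hD ?_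
    · rw [graphProcess_eq]
      exact positionGraph_mono π (positions_subset (Nat.zero_le _) hτ₀)
    · rw [graphProcess_eq]
      refine disjoint_positionGraph π (Finset.disjoint_left.2 fun i => ?_)
      simp only [mem_positions]
      omega
    · intro v hv
      simp only [smallVertices, Finset.mem_filter, Finset.mem_univ, true_and, not_le] at hv
      exact hv
    · intro u hu v hv huv
      exact hsm1 u hu v hv huv.ne (hG₁ huv)
    · intro u hu v hv huv w h1 h2
      exact hsm2 u hu v hv huv w (hG₁ h1) (hG₁ h2)
    · intro T hT hTs
      refine lt_of_le_of_lt (Finset.card_le_card ?_) (hsparse T hT hTs)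
      intro p
      simp only [Finset.mem_filter]
      exact fun h => ⟨h.1, hG₁ h.2⟩
    · simpa using hcut
  have hmin : ∀ P : SimpleGraph (Fin n) → Prop, P (graphProcess π τ) →
      (∀ G, P G → HasMinDegreeAtLeast (2 * k) G) → hittingTime π P = τ := by
    intro P hP hPd
    apply le_antisymm
    · exact sInf_le ⟨τ, ⟨hτN, hP⟩, rfl⟩
    · refine le_sInf ?_
      rintro _ ⟨t, ⟨ht, hPt⟩, rfl⟩
      exact Nat.cast_le.2 (Nat.find_min' hex ⟨ht, hPd _ hPt⟩)
  rw [hmin _ hwin fun G h => h.hasMinDegreeAtLeast, hmin _ hτ fun G h => h]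
  exact ⟨rfl, ENat.natCast_ne_top τ⟩

/-- The pairs with one element in `A` and the other in `B`. -/
def pairsBetween (A B : Finset (Fin n)) : Finset {e : Sym2 (Fin n) // ¬ e.IsDiag} :=
  Finset.univ.filter fun e => ∃ p ∈ A ×ˢ B, s(p.1, p.2) = e.1

theorem mem_pairsBetween {A B : Finset (Fin n)} {e : {e : Sym2 (Fin n) // ¬ e.IsDiag}} :
    e ∈ pairsBetween A B ↔ ∃ a ∈ A, ∃ b ∈ B, s(a, b) = e.1 := by
  simp only [pairsBetween, Finset.mem_filter, Finset.mem_univ, true_and, Finset.mem_product,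
    Prod.exists]
  exact ⟨fun ⟨a, b, h, e⟩ => ⟨a, h.1, b, h.2, e⟩, fun ⟨a, ha, b, hb, e⟩ => ⟨a, b, ⟨ha, hb⟩, e⟩⟩

theorem card_filter_pairsBetween {A B : Finset (Fin n)} (h : Disjoint A B)
    (Q : {e : Sym2 (Fin n) // ¬ e.IsDiag} → Prop) [DecidablePred Q]
    [DecidablePred fun p : Fin n × Fin n => ∃ h : ¬ s(p.1, p.2).IsDiag, Q ⟨s(p.1, p.2), h⟩] :
    ((pairsBetween A B).filter Q).card =
      ((A ×ˢ B).filter fun p => ∃ h : ¬ s(p.1, p.2).IsDiag, Q ⟨s(p.1, p.2), h⟩).card := by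
  symm
  refine Finset.card_bij (fun p hp => ⟨s(p.1, p.2), (Finset.mem_filter.1 hp).2.1⟩) ?_ ?_ ?_
  · rintro p hp
    rw [Finset.mem_filter, Finset.mem_product] at hp
    rw [Finset.mem_filter, mem_pairsBetween]
    exact ⟨⟨_, hp.1.1, _, hp.1.2, rfl⟩, hp.2.2⟩
  · rintro ⟨x, y⟩ hx ⟨x', y'⟩ hx' he
    simp only [Finset.mem_filter, Finset.mem_product] at hx hx'
    rcases Sym2.eq_iff.1 (congrArg Subtype.val he) with h' | h'
    · exact Prod.ext h'.1 h'.2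
    · have h1 : x = y' := h'.1
      exact absurd (h1 ▸ hx'.1.2) (Finset.disjoint_left.1 h hx.1.1)
  · rintro ⟨e, he⟩ hm
    rw [Finset.mem_filter, mem_pairsBetween] at hm
    obtain ⟨⟨a, ha, b, hb, hab⟩, hQ⟩ := hm
    simp only at hab
    subst hab
    exact ⟨(a, b), Finset.mem_filter.2 ⟨Finset.mem_product.2 ⟨ha, hb⟩, he, hQ⟩, rfl⟩

theorem card_pairsBetween {A B : Finset (Fin n)} (h : Disjoint A B) :
    (pairsBetween A B).card = A.card * B.card := by
  classical
  have := card_filter_pairsBetween h (fun _ => True)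
  rw [Finset.filter_true, Finset.filter_true_of_mem, Finset.card_product] at this
  · exact this
  · intro p hp
    rw [Finset.mem_product] at hp
    refine ⟨?_, trivial⟩
    rw [Sym2.mk_isDiag_iff]
    exact fun he => Finset.disjoint_left.1 h hp.1 (he ▸ hp.2)

open Classical in
theorem card_filter_pairsBetween_position {A B : Finset (Fin n)} (h : Disjoint A B)
    (π : EdgeOrdering n) (P : Finset (Fin (n.choose 2))) :
    ((pairsBetween A B).filter fun e => π e ∈ P).card =
      ((A ×ˢ B).filter fun p => (positionGraph π P).Adj p.1 p.2).card := by
  rw [card_filter_pairsBetween h]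
  congr 1
  ext p
  rw [Finset.mem_filter, Finset.mem_filter, positionGraph_adj]

/-- The pairs that contain `v`. -/
def incidentPairs (v : Fin n) : Finset {e : Sym2 (Fin n) // ¬ e.IsDiag} := pairsBetween {v} {v}ᶜ

theorem card_incidentPairs (v : Fin n) : (incidentPairs v).card = n - 1 := by
  rw [incidentPairs, card_pairsBetween (by simp), Finset.card_compl]
  simp

open Classical in
theorem card_filter_incidentPairs_position (π : EdgeOrdering n) (P : Finset (Fin (n.choose 2)))
    (v : Fin n) :
    ((incidentPairs v).filter fun e => π e ∈ P).card =
      (Finset.univ.filter ((positionGraph π P).Adj v)).card := by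
  rw [incidentPairs, card_filter_pairsBetween_position (by simp)]
  refine Finset.card_bij (fun p _ => p.2) ?_ ?_ ?_
  · rintro ⟨a, b⟩ hp
    simp only [Finset.mem_filter, Finset.mem_product, Finset.mem_singleton, Finset.mem_compl,
      Finset.mem_univ, true_and] at hp ⊢
    exact hp.1.1 ▸ hp.2
  · rintro ⟨a, b⟩ hp ⟨a', b'⟩ hp' he
    simp only [Finset.mem_filter, Finset.mem_product, Finset.mem_singleton] at hp hp'
    exact Prod.ext (hp.1.1.trans hp'.1.1.symm) he
  · intro b hb
    rw [Finset.mem_filter] at hb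
    exact ⟨(v, b), by simpa using ⟨hb.2.ne', hb.2⟩, rfl⟩

theorem mem_incidentPairs {v : Fin n} {e : {e : Sym2 (Fin n) // ¬ e.IsDiag}} : e ∈ incidentPairs v ↔ v ∈ e.1 := by
  rw [incidentPairs, mem_pairsBetween]
  obtain ⟨e, he⟩ := e
  simp only [Finset.mem_singleton, Finset.mem_compl, exists_eq_left]
  constructor
  · rintro ⟨b, hb, rfl⟩
    simp
  · intro hv
    obtain ⟨b, rfl⟩ := hv
    refine ⟨b, ?_, rfl⟩
    rintro rfl
    simp at he

theorem card_incidentPairs_union {u v : Fin n} (h : u ≠ v) : (incidentPairs u ∪ incidentPairs v).card = 2 * n - 3 := by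
  have h1 : incidentPairs u ∩ incidentPairs v = {⟨s(u, v), by simpa using h⟩} := by
    ext ⟨e, he⟩
    rw [Finset.mem_inter, mem_incidentPairs, mem_incidentPairs, Finset.mem_singleton, Subtype.mk.injEq]
    exact Sym2.mem_and_mem_iff h
  have h2 := Finset.card_union_add_card_inter (incidentPairs u) (incidentPairs v)
  rw [h1, Finset.card_singleton, card_incidentPairs, card_incidentPairs] at h2
  have := u.2
  have := v.2
  have : (u : ℕ) ≠ v := fun e => h (Fin.ext e)
  omega

/-- The pairs inside `T`. -/
def pairsIn (T : Finset (Fin n)) : Finset {e : Sym2 (Fin n) // ¬ e.IsDiag} :=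
  Finset.univ.filter fun e => ∀ v ∈ e.1, v ∈ T

theorem two_mul_card_pairsIn_le (T : Finset (Fin n)) : 2 * (pairsIn T).card ≤ T.card ^ 2 := by
  have h1 : (pairsIn T).card ≤ (T.offDiag.image Sym2.mk.uncurry).card := by
    refine Finset.card_le_card_of_injOn Subtype.val ?_ Subtype.val_injective.injOn
    rintro ⟨e, he⟩ hm
    have hm := (Finset.mem_filter.1 (Finset.mem_coe.1 hm)).2
    induction e using Sym2.ind with
    | _ x y =>
      refine Finset.mem_coe.2 (Finset.mem_image.2 ⟨(x, y), ?_, rfl⟩)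
      rw [Finset.mem_offDiag]
      exact ⟨hm x (by simp), hm y (by simp), by simpa using he⟩
  have h2 := Sym2.two_mul_card_image_offDiag T
  have h3 : T.offDiag.card ≤ T.card ^ 2 := by
    rw [Finset.offDiag_card, sq]
    exact Nat.sub_le _ _
  omega

open Classical in
theorem card_filter_adj_le (π : EdgeOrdering n) (P : Finset (Fin (n.choose 2)))
    (T : Finset (Fin n)) :
    ((T ×ˢ T).filter fun p => (positionGraph π P).Adj p.1 p.2).card ≤
      2 * ((pairsIn T).filter fun e => π e ∈ P).card := by
  have h1 : ((T ×ˢ T).filter fun p => (positionGraph π P).Adj p.1 p.2).card ≤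
      ∑ e ∈ (pairsIn T).filter fun e => π e ∈ P,
        ((T ×ˢ T).filter fun p => s(p.1, p.2) = e.1).card := by
    refine le_trans (Finset.card_le_card ?_) Finset.card_biUnion_le
    rintro ⟨x, y⟩ hp
    simp only [Finset.mem_filter, Finset.mem_product] at hp
    obtain ⟨hd, hP⟩ := positionGraph_adj.1 hp.2
    rw [Finset.mem_biUnion]
    refine ⟨⟨s(x, y), hd⟩, ?_, by simpa using hp.1⟩
    rw [Finset.mem_filter, pairsIn, Finset.mem_filter]
    refine ⟨⟨Finset.mem_univ _, fun v hv => ?_⟩, hP⟩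
    rcases Sym2.mem_iff.1 hv with rfl | rfl
    exacts [hp.1.1, hp.1.2]
  refine h1.trans ?_
  rw [mul_comm, ← smul_eq_mul]
  refine Finset.sum_le_card_nsmul _ _ _ fun e _ => ?_
  obtain ⟨e, he⟩ := e
  induction e using Sym2.ind with
  | _ x y =>
    refine le_trans (Finset.card_le_card (t := {(x, y), (y, x)}) ?_) Finset.card_le_two
    rintro ⟨x', y'⟩ hp
    rcases Sym2.eq_iff.1 (Finset.mem_filter.1 hp).2 with h | h
    · simp only at h
      simp [h.1, h.2]
    · simp only at h
      simp [h.1, h.2]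

end ProcessGraphs

/-! ### Probabilities of the bad events at given times -/

section Bounds

variable {n : ℕ}

instance : Nonempty (EdgeOrdering n) := nonempty_edgeOrdering n

open Classical in
/-- Some vertex has degree less than `d` after `t` steps. -/
theorem prob_exists_degree_lt_le {t d : ℕ} (ht : t ≤ n.choose 2) (hn : n - 1 < n.choose 2) :
    orderingProb {π : EdgeOrdering n |
      ∃ v, (Finset.univ.filter ((graphProcess π t).Adj v)).card < d} ≤
      n * (2 ^ d * Real.exp (-(1 / 2 * ((t : ℝ) / (n.choose 2 : ℕ)) * (n - 1 : ℕ)))) := by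
  have hsub : {π : EdgeOrdering n |
      ∃ v, (Finset.univ.filter ((graphProcess π t).Adj v)).card < d} ⊆
      ⋃ v ∈ (Finset.univ : Finset (Fin n)), {π : EdgeOrdering n |
        ((incidentPairs v).filter fun e => π e ∈ positions _ 0 t).card ≤ d} := by
    rintro π ⟨v, hv⟩
    simp only [Set.mem_iUnion, Finset.mem_univ, exists_true_left]
    refine ⟨v, ?_⟩
    rw [Set.mem_ofPred_eq, card_filter_incidentPairs_position, ← graphProcess_eq]
    exact hv.le
  refine (orderingProb_mono hsub).trans ((orderingProb_biUnion_le _ _).trans ?_)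
  have h1 : ∀ v ∈ (Finset.univ : Finset (Fin n)), orderingProb {π : EdgeOrdering n |
        ((incidentPairs v).filter fun e => π e ∈ positions _ 0 t).card ≤ d} ≤
      2 ^ d * Real.exp (-(1 / 2 * ((t : ℝ) / (n.choose 2 : ℕ)) * (n - 1 : ℕ))) := by
    intro v _
    have := orderingProb_lower_tail (incidentPairs v) (positions (n.choose 2) 0 t)
      (by rwa [card_incidentPairs]) (K := 2) (by norm_num) d
    rw [card_incidentPairs, card_positions ht] at this
    norm_num at this ⊢
    exact this
  refine (Finset.sum_le_sum h1).trans (le_of_eq ?_)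
  simp

/-- Two disjoint sets of at least `a` vertices have at most `m` edges between them after `t`
steps. -/
theorem prob_exists_sparse_cut_le {t m a : ℕ} (ht : t ≤ n.choose 2) (hn : n ^ 2 < 4 * n.choose 2) :
    orderingProb {π : EdgeOrdering n | ∃ A B : Finset (Fin n), Disjoint A B ∧ a ≤ A.card ∧
      a ≤ B.card ∧ ((pairsBetween A B).filter fun e => π e ∈ positions _ 0 t).card ≤ m} ≤
      4 ^ n * (2 ^ m * Real.exp (-(1 / 2 * ((t : ℝ) / (n.choose 2 : ℕ)) * a ^ 2))) := by
  classical
  set I := (Finset.univ : Finset (Finset (Fin n) × Finset (Fin n))).filter fun p =>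
    Disjoint p.1 p.2 ∧ a ≤ p.1.card ∧ a ≤ p.2.card with hI
  have hsub : {π : EdgeOrdering n | ∃ A B : Finset (Fin n), Disjoint A B ∧ a ≤ A.card ∧
      a ≤ B.card ∧ ((pairsBetween A B).filter fun e => π e ∈ positions _ 0 t).card ≤ m} ⊆
      ⋃ p ∈ I, {π : EdgeOrdering n |
        ((pairsBetween p.1 p.2).filter fun e => π e ∈ positions _ 0 t).card ≤ m} := by
    rintro π ⟨A, B, hd, hA, hB, h⟩
    simp only [Set.mem_iUnion]
    exact ⟨(A, B), by simp [hI, hd, hA, hB], h⟩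
  refine (orderingProb_mono hsub).trans ((orderingProb_biUnion_le _ _).trans ?_)
  have h1 : ∀ p ∈ I, orderingProb {π : EdgeOrdering n |
        ((pairsBetween p.1 p.2).filter fun e => π e ∈ positions _ 0 t).card ≤ m} ≤
      2 ^ m * Real.exp (-(1 / 2 * ((t : ℝ) / (n.choose 2 : ℕ)) * a ^ 2)) := by
    rintro ⟨A, B⟩ hp
    simp only [hI, Finset.mem_filter, Finset.mem_univ, true_and] at hp
    have hAB : A.card + B.card ≤ n := by
      rw [← Finset.card_union_of_disjoint hp.1]
      exact card_finset_fin_le _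
    -- The tail bound needs a proper part of the set of all pairs; the inequality of the means gives
    -- `4 |A| |B| ≤ n ^ 2`.
    have h2 : A.card * B.card < n.choose 2 := by
      have : 4 * (A.card * B.card) ≤ n ^ 2 := by
        zify at hAB ⊢
        nlinarith [sq_nonneg ((A.card : ℤ) - B.card)]
      omega
    have := orderingProb_lower_tail (pairsBetween A B) (positions (n.choose 2) 0 t)
      (by rwa [card_pairsBetween hp.1]) (K := 2) (by norm_num) m
    rw [card_pairsBetween hp.1, card_positions ht] at this
    refine this.trans ?_
    have h3 : (a : ℝ) ^ 2 ≤ (A.card * B.card : ℕ) := by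
      rw [sq]
      exact_mod_cast Nat.mul_le_mul hp.2.1 hp.2.2
    norm_num only [Nat.sub_zero]
    gcongr
  refine (Finset.sum_le_sum h1).trans ?_
  rw [Finset.sum_const, nsmul_eq_mul]
  have hc : (I.card : ℝ) ≤ 4 ^ n := by
    have : I.card ≤ 4 ^ n := by
      refine (Finset.card_le_univ I).trans (le_of_eq ?_)
      rw [Fintype.card_prod, Fintype.card_finset, Fintype.card_fin,
        show (4 : ℕ) = 2 * 2 from rfl, mul_pow]
    exact_mod_cast this
  gcongr

/-- Some set of at most `s` vertices spans at least `b` times as many edges after `t` steps. -/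
theorem prob_exists_dense_le {t b s : ℕ} (ht : t ≤ n.choose 2) (hs : s ^ 2 < 2 * n.choose 2)
    {θ y : ℝ} (hθ : 1 ≤ θ)
    (hy : Real.exp (θ * ((t : ℝ) / (n.choose 2 : ℕ)) * s / 2) ≤ θ ^ b * y) :
    orderingProb {π : EdgeOrdering n | ∃ T : Finset (Fin n), T.Nonempty ∧ T.card ≤ s ∧
      b * T.card ≤ ((pairsIn T).filter fun e => π e ∈ positions _ 0 t).card} ≤
      (1 + y) ^ n - 1 := by
  classical
  have hθ0 : 0 < θ := by linarith
  have hy0 : 0 ≤ y := by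
    have h1 : 0 < θ ^ b * y := (Real.exp_pos _).trans_le hy
    exact (pos_of_mul_pos_right h1 (by positivity)).le
  set I := (Finset.univ : Finset (Finset (Fin n))).filter fun T => T.Nonempty ∧ T.card ≤ s with hI
  have hsub : {π : EdgeOrdering n | ∃ T : Finset (Fin n), T.Nonempty ∧ T.card ≤ s ∧
      b * T.card ≤ ((pairsIn T).filter fun e => π e ∈ positions _ 0 t).card} ⊆
      ⋃ T ∈ I, {π : EdgeOrdering n |
        b * T.card ≤ ((pairsIn T).filter fun e => π e ∈ positions _ 0 t).card} := by
    rintro π ⟨T, hT, hTs, h⟩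
    simp only [Set.mem_iUnion]
    exact ⟨T, by simp [hI, hT, hTs], h⟩
  refine (orderingProb_mono hsub).trans ((orderingProb_biUnion_le _ _).trans ?_)
  have h1 : ∀ T ∈ I, orderingProb {π : EdgeOrdering n |
        b * T.card ≤ ((pairsIn T).filter fun e => π e ∈ positions _ 0 t).card} ≤
      y ^ T.card := by
    intro T hT
    simp only [hI, Finset.mem_filter, Finset.mem_univ, true_and] at hT
    have hc := two_mul_card_pairsIn_le T
    have hTs : T.card ^ 2 ≤ s ^ 2 := Nat.pow_le_pow_left hT.2 2
    have h2 := orderingProb_upper_tail (pairsIn T) (positions (n.choose 2) 0 t)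
      (by omega) hθ (b * T.card)
    rw [card_positions ht, Nat.sub_zero] at h2
    -- Since `|T| ≤ s`, the number of pairs in `T` is at most `|T| s / 2`, which makes the exponent
    -- linear in `|T|` and the bound a power `y ^ |T|`.
    have h3 : θ * ((t : ℝ) / (n.choose 2 : ℕ)) * (pairsIn T).card ≤
        T.card * (θ * ((t : ℝ) / (n.choose 2 : ℕ)) * s / 2) := by
      have h4 : 2 * ((pairsIn T).card : ℝ) ≤ T.card * s := by
        have : 2 * (pairsIn T).card ≤ T.card * s :=
          hc.trans (by rw [sq]; exact Nat.mul_le_mul_left _ hT.2)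
        exact_mod_cast this
      have h5 : 0 ≤ θ * ((t : ℝ) / (n.choose 2 : ℕ)) := by positivity
      nlinarith
    have h4 : orderingProb {π : EdgeOrdering n |
        b * T.card ≤ ((pairsIn T).filter fun e => π e ∈ positions _ 0 t).card} *
        θ ^ (b * T.card) ≤ y ^ T.card * θ ^ (b * T.card) := by
      refine h2.trans ((Real.exp_le_exp.2 h3).trans ?_)
      rw [Real.exp_nat_mul, pow_mul, ← mul_pow, mul_comm y]
      exact pow_le_pow_left₀ (Real.exp_pos _).le hy _
    exact le_of_mul_le_mul_right h4 (by positivity)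
  refine (Finset.sum_le_sum h1).trans ?_
  -- Over all sets `T` the sum of `y ^ |T|` is `(1 + y) ^ n`; leaving out the empty set gives the `-
  -- 1`.
  have h2 := Finset.sum_pow_mul_eq_add_pow y 1 (Finset.univ : Finset (Fin n))
  simp only [one_pow, mul_one, Finset.card_univ, Fintype.card_fin, Finset.powerset_univ] at h2
  rw [add_comm, ← h2, ← Finset.add_sum_erase _ _ (Finset.mem_univ ∅), Finset.card_empty, pow_zero,
    add_sub_cancel_left]
  refine Finset.sum_le_sum_of_subset_of_nonneg ?_ fun T _ _ => by positivity
  intro T hT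
  simp only [hI, Finset.mem_filter, Finset.mem_univ, true_and] at hT
  simp [hT.1.ne_empty]

open Classical in
/-- Two vertices of degree at most `d` in the graph formed by the positions in `[r, t₀)` are
adjacent after `t` steps (if `w = u`), or both adjacent to `w`. -/
theorem prob_small_pair_le {r t₀ t d : ℕ} (ht₀ : t₀ ≤ n.choose 2) (ht : t + 2 * n ≤ n.choose 2)
    (hn : 3 ≤ n) {u v w : Fin n} (huv : u ≠ v)
    {F : Finset {e : Sym2 (Fin n) // ¬ e.IsDiag}} (hF : ∀ e ∈ F, ∀ x ∈ e.1, x = u ∨ x = v ∨ x = w) :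
    orderingProb ({π : EdgeOrdering n | u ∈ smallVertices π r t₀ d ∧ v ∈ smallVertices π r t₀ d} ∩
      mapsInto F (positions _ 0 t)) ≤
      8 ^ (2 * d) * Real.exp (-(7 / 8 * (((t₀ - r : ℕ) : ℝ) / (n.choose 2 : ℕ)) *
          (2 * (n - 3) : ℕ))) *
        ((t : ℝ) / ((n.choose 2 : ℕ) - 2 * n)) ^ F.card := by
  -- The degrees are tested only on pairs from `{u, v}` to `Z`. These are disjoint from `F`, whose
  -- pairs lie inside `{u, v, w}`, so the joint tail bound applies.
  set Z : Finset (Fin n) := {u, v, w}ᶜ with hZ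
  have hdis : Disjoint ({u, v} : Finset (Fin n)) Z := by
    rw [Finset.disjoint_left]
    intro x hx
    simp only [hZ, Finset.mem_compl, Finset.mem_insert, Finset.mem_singleton] at hx ⊢
    tauto
  set X := pairsBetween {u, v} Z with hX
  have hZc : n - 3 ≤ Z.card := by
    rw [hZ, Finset.card_compl, Fintype.card_fin]
    have : ({u, v, w} : Finset (Fin n)).card ≤ 3 := Finset.card_le_three
    omega
  have hZn : Z.card + 1 ≤ n := by
    have h1 := Finset.card_lt_univ_of_notMem (show u ∉ Z by simp [hZ])
    simpa using h1
  have hXc : X.card = 2 * Z.card := by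
    rw [hX, card_pairsBetween hdis, Finset.card_pair huv]
  have hXF : Disjoint X F := by
    rw [Finset.disjoint_left]
    intro e he heF
    obtain ⟨a, -, b, hb, hab⟩ := mem_pairsBetween.1 he
    have := hF e heF b (by rw [← hab]; simp)
    simp only [hZ, Finset.mem_compl, Finset.mem_insert, Finset.mem_singleton] at hb
    exact hb this
  have hsub : {π : EdgeOrdering n | u ∈ smallVertices π r t₀ d ∧ v ∈ smallVertices π r t₀ d} ⊆
      {π : EdgeOrdering n | (X.filter fun x => π x ∈ positions _ r t₀).card ≤ 2 * d} := by
    rintro π ⟨hu, hv⟩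
    simp only [smallVertices, Finset.mem_filter, Finset.mem_univ, true_and] at hu hv
    rw [← card_filter_incidentPairs_position] at hu hv
    have h1 : X.filter (fun x => π x ∈ positions _ r t₀) ⊆
        (incidentPairs u).filter (fun x => π x ∈ positions _ r t₀) ∪
        (incidentPairs v).filter (fun x => π x ∈ positions _ r t₀) := by
      intro e he
      rw [Finset.mem_filter, hX, mem_pairsBetween] at he
      obtain ⟨⟨a, ha, b, -, hab⟩, hP⟩ := he
      simp only [Finset.mem_union, Finset.mem_filter, mem_incidentPairs, ← hab]
      simp only [Finset.mem_insert, Finset.mem_singleton] at ha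
      rcases ha with rfl | rfl
      · exact .inl ⟨by simp, hP⟩
      · exact .inr ⟨by simp, hP⟩
    have := (Finset.card_le_card h1).trans (Finset.card_union_le _ _)
    rw [Set.mem_ofPred_eq]
    omega
  refine (orderingProb_mono (Set.inter_subset_inter_left _ hsub)).trans ?_
  have htp : (positions (n.choose 2) 0 t).card = t := by
    rw [card_positions (by omega), Nat.sub_zero]
  -- `K = 8` gives the rate `7 / 8`. With `K = 2` the rate `1 / 2` would be too weak for the union
  -- over pairs of vertices at the times chosen later.
  refine (orderingProb_lower_tail_inter hXF (by omega) (by omega) (K := 8) (by norm_num) _).trans ?_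
  rw [htp, card_positions ht₀]
  have h2 : ((2 * (n - 3) : ℕ) : ℝ) ≤ X.card := by
    exact_mod_cast (by omega : 2 * (n - 3) ≤ X.card)
  have h3 : (X.card : ℝ) ≤ 2 * n := by
    exact_mod_cast (by omega : X.card ≤ 2 * n)
  -- The denominator `N - 2 n` is known to be positive only for `t > 0`; for `t = 0` the numerators
  -- vanish and the denominators do not matter.
  have h4 : (2 : ℝ) * n < (n.choose 2 : ℕ) ∨ t = 0 := by
    rcases Nat.eq_zero_or_pos t with h | h
    · exact .inr h
    · left
      exact_mod_cast (by omega : 2 * n < n.choose 2)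
  have h78 : (1 : ℝ) - 1 / 8 = 7 / 8 := by norm_num
  rw [h78]
  rcases h4 with h4 | rfl
  · have h5 : (0 : ℝ) < (n.choose 2 : ℕ) - 2 * n := by linarith
    have h6 : (0 : ℝ) < (n.choose 2 : ℕ) - X.card := by linarith
    gcongr
  · simp only [Nat.cast_zero, zero_div]
    gcongr

open Classical in
-- Union bound over edges `uv` and over paths `u w v`: about `n ^ 2` choices with one prescribed
-- edge and `n ^ 3` choices with two.
theorem prob_small_close_le {r t₀ t d : ℕ} (ht₀ : t₀ ≤ n.choose 2)
    (ht : t + 2 * n ≤ n.choose 2) (hn : 3 ≤ n) {y p : ℝ}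
    (hy : 8 ^ (2 * d) * Real.exp (-(7 / 8 * (((t₀ - r : ℕ) : ℝ) / (n.choose 2 : ℕ)) *
          (2 * (n - 3) : ℕ))) ≤ y)
    (hp0 : 0 ≤ (t : ℝ) / ((n.choose 2 : ℕ) - 2 * n))
    (hp : (t : ℝ) / ((n.choose 2 : ℕ) - 2 * n) ≤ p) :
    orderingProb {π : EdgeOrdering n | ∃ u v, u ≠ v ∧ u ∈ smallVertices π r t₀ d ∧
      v ∈ smallVertices π r t₀ d ∧ ((graphProcess π t).Adj u v ∨
        ∃ w, (graphProcess π t).Adj u w ∧ (graphProcess π t).Adj v w)} ≤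
      n ^ 2 * (y * p) + n ^ 3 * (y * p ^ 2) := by
  have hy0 : 0 ≤ y := le_trans (by positivity) hy
  have hp0' : 0 ≤ p := hp0.trans hp
  set S : Fin n → Fin n → Set (EdgeOrdering n) := fun u v =>
    {π | u ∈ smallVertices π r t₀ d ∧ v ∈ smallVertices π r t₀ d} with hS
  set I₁ := (Finset.univ : Finset (Fin n × Fin n)).filter fun q => q.1 ≠ q.2
  set I₂ := (Finset.univ : Finset (Fin n × Fin n × Fin n)).filter fun q => q.1 ≠ q.2.1
  set B₁ : Fin n × Fin n → Set (EdgeOrdering n) := fun q =>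
    S q.1 q.2 ∩ {π | (graphProcess π t).Adj q.1 q.2} with hB₁
  set B₂ : Fin n × Fin n × Fin n → Set (EdgeOrdering n) := fun q =>
    S q.1 q.2.1 ∩ {π | (graphProcess π t).Adj q.1 q.2.2 ∧ (graphProcess π t).Adj q.2.1 q.2.2}
    with hB₂
  have hsub : {π : EdgeOrdering n | ∃ u v, u ≠ v ∧ u ∈ smallVertices π r t₀ d ∧
      v ∈ smallVertices π r t₀ d ∧ ((graphProcess π t).Adj u v ∨
        ∃ w, (graphProcess π t).Adj u w ∧ (graphProcess π t).Adj v w)} ⊆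
      (⋃ q ∈ I₁, B₁ q) ∪ ⋃ q ∈ I₂, B₂ q := by
    rintro π ⟨u, v, huv, hu, hv, h | ⟨w, h⟩⟩
    · left
      simp only [Set.mem_iUnion]
      exact ⟨(u, v), by simp [I₁, huv], ⟨hu, hv⟩, h⟩
    · right
      simp only [Set.mem_iUnion]
      exact ⟨(u, v, w), by simp [I₂, huv], ⟨hu, hv⟩, h⟩
  have h1 : ∀ q ∈ I₁, orderingProb (B₁ q) ≤ y * p := by
    rintro ⟨u, v⟩ hq
    have huv : u ≠ v := (Finset.mem_filter.1 hq).2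
    set e : {e : Sym2 (Fin n) // ¬ e.IsDiag} := ⟨s(u, v), by simpa using huv⟩ with he
    have hle : B₁ (u, v) ⊆ S u v ∩ mapsInto {e} (positions _ 0 t) := by
      rintro π ⟨hs, hadj⟩
      refine ⟨hs, ?_⟩
      rw [Set.mem_ofPred_eq, graphProcess_eq, positionGraph_adj] at hadj
      obtain ⟨hd, hm⟩ := hadj
      rw [mem_mapsInto]
      intro x hx
      rw [Finset.mem_singleton] at hx
      rw [hx]
      exact hm
    refine (orderingProb_mono hle).trans ((prob_small_pair_le ht₀ ht hn huv (w := u) ?_).trans ?_)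
    · intro x hx z hz
      rw [Finset.mem_singleton] at hx
      rw [hx, he] at hz
      rcases Sym2.mem_iff.1 hz with h | h <;> simp [h]
    · rw [Finset.card_singleton, pow_one]
      gcongr
  have h2 : ∀ q ∈ I₂, orderingProb (B₂ q) ≤ y * p ^ 2 := by
    rintro ⟨u, v, w⟩ hq
    have huv : u ≠ v := (Finset.mem_filter.1 hq).2
    by_cases hw : w = u ∨ w = v
    · have : B₂ (u, v, w) = ∅ := by
        ext π
        simp only [hB₂, Set.mem_inter_iff, Set.mem_ofPred_eq, Set.mem_empty_iff_false, iff_false]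
        rintro ⟨-, h1, h2⟩
        rcases hw with rfl | rfl
        exacts [h1.ne rfl, h2.ne rfl]
      rw [this]
      have : orderingProb (∅ : Set (EdgeOrdering n)) = 0 := by simp [orderingProb]
      rw [this]
      positivity
    push Not at hw
    set e : {e : Sym2 (Fin n) // ¬ e.IsDiag} := ⟨s(u, w), by simpa using hw.1.symm⟩ with he
    set e' : {e : Sym2 (Fin n) // ¬ e.IsDiag} := ⟨s(v, w), by simpa using hw.2.symm⟩ with he'
    have hee : e ≠ e' := by
      intro h
      rcases Sym2.eq_iff.1 (congrArg Subtype.val h) with h | h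
      exacts [huv h.1, hw.1 h.1.symm]
    have hle : B₂ (u, v, w) ⊆ S u v ∩ mapsInto {e, e'} (positions _ 0 t) := by
      rintro π ⟨hs, hadj⟩
      refine ⟨hs, ?_⟩
      rw [Set.mem_ofPred_eq, graphProcess_eq, positionGraph_adj, positionGraph_adj] at hadj
      obtain ⟨⟨hd, hm⟩, hd', hm'⟩ := hadj
      rw [mem_mapsInto]
      intro x hx
      rw [Finset.mem_insert, Finset.mem_singleton] at hx
      rcases hx with hx | hx
      · rw [hx]; exact hm
      · rw [hx]; exact hm'
    refine (orderingProb_mono hle).trans ((prob_small_pair_le ht₀ ht hn huv (w := w) ?_).trans ?_)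
    · intro x hx z hz
      rw [Finset.mem_insert, Finset.mem_singleton] at hx
      rcases hx with hx | hx
      · rw [hx, he] at hz
        rcases Sym2.mem_iff.1 hz with h | h <;> simp [h]
      · rw [hx, he'] at hz
        rcases Sym2.mem_iff.1 hz with h | h <;> simp [h]
    · rw [Finset.card_pair hee]
      gcongr
  have hc1 : (I₁.card : ℝ) ≤ n ^ 2 := by
    have : I₁.card ≤ n ^ 2 := (Finset.card_le_univ _).trans (by simp [sq])
    exact_mod_cast this
  have hc2 : (I₂.card : ℝ) ≤ n ^ 3 := by
    have : I₂.card ≤ n ^ 3 := (Finset.card_le_univ _).trans (by simp [pow_succ, mul_assoc])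
    exact_mod_cast this
  refine (orderingProb_mono hsub).trans ((orderingProb_union_le _ _).trans (add_le_add ?_ ?_))
  · refine (orderingProb_biUnion_le _ _).trans ((Finset.sum_le_sum h1).trans ?_)
    rw [Finset.sum_const, nsmul_eq_mul]
    gcongr
  · refine (orderingProb_biUnion_le _ _).trans ((Finset.sum_le_sum h2).trans ?_)
    rw [Finset.sum_const, nsmul_eq_mul]
    gcongr

/-- No vertex is isolated after `t` steps. -/
theorem prob_no_isolated_le {t : ℕ} (hn : 3 ≤ n) (ht : t + 2 * n < n.choose 2) {g : ℝ}
    (hg : g = ((n.choose 2 - t : ℕ) - (n - 2 : ℕ) : ℝ) / ((n.choose 2 : ℕ) - (n - 2 : ℕ))) :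
    orderingProb {π : EdgeOrdering n | ∀ v, ∃ u, (graphProcess π t).Adj v u} ≤
      1 / (n * g ^ n) + (1 / g - 1) := by
  classical
  set N := n.choose 2 with hN
  -- `G i` is the chance that one more pair avoids the first `t` positions after `i` pairs have
  -- avoided them. It decreases in `i`, and `g = G (n - 2)` is the last factor of `q`.
  set G : ℕ → ℝ := fun i => (((N - t : ℕ) : ℝ) - i) / ((N : ℝ) - i) with hG
  have htN : ((N - t : ℕ) : ℝ) = N - t := by rw [Nat.cast_sub (by omega)]
  have ht' : (t : ℝ) + 2 * n < N := by exact_mod_cast ht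
  have ht0 : (0 : ℝ) ≤ t := by positivity
  have hn' : (3 : ℝ) ≤ n := by exact_mod_cast hn
  have hGpos : ∀ i : ℕ, i ≤ 2 * n → 0 < G i := by
    intro i hi
    have hi : (i : ℝ) ≤ 2 * n := by exact_mod_cast hi
    simp only [hG, htN]
    exact div_pos (by linarith) (by linarith)
  have hGanti : ∀ i j : ℕ, i ≤ j → j ≤ 2 * n → G j ≤ G i := by
    intro i j hij hj
    have hij : (i : ℝ) ≤ j := by exact_mod_cast hij
    have hj : (j : ℝ) ≤ 2 * n := by exact_mod_cast hj
    simp only [hG, htN]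
    rw [div_le_div_iff₀ (by linarith) (by linarith)]
    nlinarith
  have hG1 : ∀ i : ℕ, i ≤ 2 * n → G i ≤ 1 := by
    intro i hi
    have hi : (i : ℝ) ≤ 2 * n := by exact_mod_cast hi
    simp only [hG, htN]
    rw [div_le_one (by linarith)]
    linarith
  have hgG : g = G (n - 2) := hg
  have hg0 : 0 < g := hgG ▸ hGpos _ (by omega)
  set A : Finset (Fin N) := (positions N 0 t)ᶜ with hA
  have hAc : A.card = N - t := by
    rw [hA, Finset.card_compl, Fintype.card_fin, card_positions (by omega), Nat.sub_zero]
  set q : ℝ := ∏ i ∈ Finset.range (n - 1), G i with hq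
  have hqpos : 0 < q := Finset.prod_pos fun i hi => hGpos i (by
    have := Finset.mem_range.1 hi
    omega)
  have h1 : ∀ v : Fin n, orderingProb (mapsInto (incidentPairs v) A) = q := by
    intro v
    rw [orderingProb_mapsInto, card_incidentPairs, hAc]
  have h2 : ∀ u v : Fin n, u ≠ v →
      orderingProb (mapsInto (incidentPairs u) A ∩ mapsInto (incidentPairs v) A) ≤ q ^ 2 / g := by
    intro u v huv
    have : mapsInto (incidentPairs u) A ∩ mapsInto (incidentPairs v) A =
        (mapsInto (incidentPairs u ∪ incidentPairs v) A : Set (EdgeOrdering n)) := by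
      ext π
      simp only [Set.mem_inter_iff, mem_mapsInto, Finset.mem_union]
      exact ⟨fun h x hx => hx.elim (h.1 x) (h.2 x),
        fun h => ⟨fun x hx => h x (.inl hx), fun x hx => h x (.inr hx)⟩⟩
    -- Two stars share one pair, so the joint probability has `n - 2` further factors after `q`.
    -- Each is at most the corresponding early factor, and the product of the early ones is `q / g`.
    rw [this, orderingProb_mapsInto, card_incidentPairs_union huv, hAc,
      show 2 * n - 3 = (n - 1) + (n - 2) by omega, Finset.prod_range_add, sq, mul_div_assoc]
    refine mul_le_mul_of_nonneg_left ?_ hqpos.le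
    rw [le_div_iff₀ hg0, hq, show n - 1 = (n - 2) + 1 by omega, Finset.prod_range_succ, ← hgG]
    refine mul_le_mul_of_nonneg_right ?_ hg0.le
    refine Finset.prod_le_prod (fun i hi => (hGpos _ ?_).le) fun i hi => hGanti _ _ ?_ ?_
    all_goals
      have := Finset.mem_range.1 hi
      omega
  have h3 := orderingProb_none_le (fun v : Fin n => mapsInto (incidentPairs v) A) hqpos hg0
    (by simp; omega) h1 h2
  have hsub : {π : EdgeOrdering n | ∀ v, ∃ u, (graphProcess π t).Adj v u} ⊆
      {π | ∀ v, π ∉ mapsInto (incidentPairs v) A} := by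
    intro π hπ v hv
    obtain ⟨u, hu⟩ := hπ v
    rw [graphProcess_eq, positionGraph_adj] at hu
    obtain ⟨hd, hm⟩ := hu
    have := hv ⟨s(v, u), hd⟩ (by rw [mem_incidentPairs]; simp)
    rw [hA, Finset.mem_compl] at this
    exact this hm
  refine (orderingProb_mono hsub).trans (h3.trans ?_)
  rw [Fintype.card_fin]
  have hqg : g ^ n ≤ q := by
    calc g ^ n ≤ g ^ (n - 1) := pow_le_pow_of_le_one hg0.le (hgG ▸ hG1 _ (by omega)) (by omega)
      _ = ∏ _i ∈ Finset.range (n - 1), g := by simp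
      _ ≤ q := Finset.prod_le_prod (fun i _ => hg0.le) fun i hi => by
          have := Finset.mem_range.1 hi
          rw [hgG]
          exact hGanti _ _ (by omega) (by omega)
  gcongr

end Bounds

/-! ### Choice of the times and constants, and the limits -/

section Asymptotics

/-- A time before which there are still isolated vertices, but linear cuts are already dense. -/
noncomputable def redTime (n : ℕ) : ℕ := ⌊(n : ℝ) * Real.log n / 20⌋₊

/-- A time at which there are still isolated vertices. -/
noncomputable def lowTime (n : ℕ) : ℕ := ⌊9 * ((n : ℝ) * Real.log n) / 20⌋₊

/-- A time at which the minimum degree is already large. -/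
noncomputable def highTime (n : ℕ) : ℕ := ⌊2 * ((n : ℝ) * Real.log n)⌋₊

/-- The density bound for small sets of vertices. -/
noncomputable def smallSetDensity (k n : ℕ) : ℕ := ⌊Real.log n / (1000 * k)⌋₊

/-- The number of pairs of edges that Maker reserves at a vertex of large degree. -/
noncomputable def reservedPairs (k n : ℕ) : ℕ := 2 * smallSetDensity k n * k + 1

/-- The base of the exponential moment that controls the edges inside small sets. -/
noncomputable def momentBase (k : ℕ) : ℝ := Real.exp (8000 * k)

/-- The size up to which sets of vertices count as small. -/
noncomputable def smallSetSize (k n : ℕ) : ℕ := ⌊(n : ℝ) / (3 * momentBase k)⌋₊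

theorem one_le_momentBase (k : ℕ) : 1 ≤ momentBase k := Real.one_le_exp (by positivity)

theorem tendsto_log_natCast : Tendsto (fun n : ℕ => Real.log n) atTop atTop :=
  Real.tendsto_log_atTop.comp tendsto_natCast_atTop_atTop

theorem tendsto_log_div_natCast : Tendsto (fun n : ℕ => Real.log n / n) atTop (𝓝 0) := by
  have := (Real.isLittleO_log_id_atTop.tendsto_div_nhds_zero).comp
    (tendsto_natCast_atTop_atTop (R := ℝ))
  exact this

/-- The number `n` is large compared with absolute constants. -/
def IsLarge (n : ℕ) : Prop :=
  (1000000 : ℝ) ≤ n ∧ 1 ≤ Real.log n ∧ Real.log n ≤ n / 10000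

theorem eventually_isLarge : ∀ᶠ n : ℕ in atTop, IsLarge n := by
  have h1 := (tendsto_natCast_atTop_atTop (R := ℝ)).eventually_ge_atTop 1000000
  have h2 := tendsto_log_natCast.eventually_ge_atTop 1
  have h3 := tendsto_log_div_natCast.eventually_le_const
    (show (0 : ℝ) < 1 / 10000 by norm_num)
  filter_upwards [h1, h2, h3] with n h1 h2 h3
  refine ⟨h1, h2, ?_⟩
  rw [div_le_iff₀ (by linarith)] at h3
  linarith

namespace IsLarge

variable {n : ℕ}

theorem pos (h : IsLarge n) : (0 : ℝ) < n := by linarith [h.1]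

theorem le_mul_log (h : IsLarge n) : (1000000 : ℝ) ≤ n * Real.log n := by
  nlinarith [h.1, h.2.1]

theorem mul_log_le (h : IsLarge n) : (n : ℝ) * Real.log n ≤ n ^ 2 / 10000 := by
  nlinarith [h.2.2, h.pos]

theorem le_choose (h : IsLarge n) : 0.499 * (n : ℝ) ^ 2 ≤ (n.choose 2 : ℕ) := by
  rw [Nat.cast_choose_two]
  nlinarith [h.1]

theorem choose_le (n : ℕ) : ((n.choose 2 : ℕ) : ℝ) ≤ (n : ℝ) ^ 2 / 2 := by
  rw [Nat.cast_choose_two]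
  nlinarith [(Nat.cast_nonneg n : (0 : ℝ) ≤ n)]

theorem mul_le_sq (h : IsLarge n) : 1000000 * (n : ℝ) ≤ n ^ 2 := by
  nlinarith [h.1]

theorem redTime_le_lowTime (h : IsLarge n) : redTime n ≤ lowTime n :=
  Nat.floor_mono (by linarith [h.le_mul_log])

theorem redTime_gt (n : ℕ) : (n : ℝ) * Real.log n / 20 - 1 < redTime n := Nat.sub_one_lt_floor _

theorem redTime_le (h : IsLarge n) : (redTime n : ℝ) ≤ (n : ℝ) * Real.log n / 20 :=
  Nat.floor_le (by linarith [h.le_mul_log])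

theorem lowTime_gt (n : ℕ) : 9 * ((n : ℝ) * Real.log n) / 20 - 1 < lowTime n :=
  Nat.sub_one_lt_floor _

theorem lowTime_le (h : IsLarge n) : (lowTime n : ℝ) ≤ 9 * ((n : ℝ) * Real.log n) / 20 :=
  Nat.floor_le (by linarith [h.le_mul_log])

theorem highTime_gt (n : ℕ) : 2 * ((n : ℝ) * Real.log n) - 1 < highTime n :=
  Nat.sub_one_lt_floor _

theorem highTime_le (h : IsLarge n) : (highTime n : ℝ) ≤ 2 * ((n : ℝ) * Real.log n) :=
  Nat.floor_le (by linarith [h.le_mul_log])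

theorem highTime_add_lt (h : IsLarge n) : highTime n + 2 * n < n.choose 2 := by
  have h1 := h.highTime_le
  have h2 := h.mul_log_le
  have h3 := h.le_choose
  have h4 := h.mul_le_sq
  have : (highTime n : ℝ) + 2 * n < (n.choose 2 : ℕ) := by nlinarith [h.pos]
  exact_mod_cast this

theorem lowTime_add_lt (h : IsLarge n) : lowTime n + 2 * n < n.choose 2 := by
  have h1 := h.lowTime_le
  have h2 := h.mul_log_le
  have h3 := h.le_choose
  have h4 := h.mul_le_sq
  have : (lowTime n : ℝ) + 2 * n < (n.choose 2 : ℕ) := by nlinarith [h.pos]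
  exact_mod_cast this

theorem choose_pos (h : IsLarge n) : (0 : ℝ) < (n.choose 2 : ℕ) := by
  have := h.highTime_add_lt
  exact_mod_cast (by omega : 0 < n.choose 2)

theorem three_le (h : IsLarge n) : 1000000 ≤ n := by exact_mod_cast h.1

theorem highTime_div_le (h : IsLarge n) :
    (highTime n : ℝ) / (n.choose 2 : ℕ) ≤ 4.1 * Real.log n / n := by
  rw [div_le_div_iff₀ h.choose_pos h.pos]
  have h1 := h.highTime_le
  have h3 := h.le_choose
  have hl := h.2.1
  calc (highTime n : ℝ) * n ≤ 2 * ((n : ℝ) * Real.log n) * n := by gcongr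
    _ = 2 * Real.log n * (n : ℝ) ^ 2 := by ring
    _ ≤ 4.1 * Real.log n * (0.499 * (n : ℝ) ^ 2) := by nlinarith [mul_pos (by linarith : 0 < Real.log n) (pow_pos h.pos 2)]
    _ ≤ _ := by gcongr

theorem highTime_div_sub_le (h : IsLarge n) :
    (highTime n : ℝ) / ((n.choose 2 : ℕ) - 2 * n) ≤ 5 * Real.log n / n := by
  have h3 := h.le_choose
  have h4 := h.mul_le_sq
  have h5 : 0.4 * (n : ℝ) ^ 2 ≤ (n.choose 2 : ℕ) - 2 * n := by nlinarith [h.pos]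
  have h6 : 0 < (n : ℝ) ^ 2 := pow_pos h.pos 2
  rw [div_le_div_iff₀ (by linarith) h.pos]
  have h1 := h.highTime_le
  have hl := h.2.1
  calc (highTime n : ℝ) * n ≤ 2 * ((n : ℝ) * Real.log n) * n := by gcongr
    _ = 5 * Real.log n * (0.4 * (n : ℝ) ^ 2) := by ring
    _ ≤ _ := by gcongr

theorem le_highTime_div (h : IsLarge n) :
    3.9 * Real.log n ≤ (highTime n : ℝ) / (n.choose 2 : ℕ) * (n - 1 : ℕ) := by
  rw [div_mul_eq_mul_div, le_div_iff₀ h.choose_pos, Nat.cast_sub (by have := h.three_le; omega)]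
  have h1 := highTime_gt n
  have h2 := h.le_mul_log
  have h3 := h.1
  have hl := h.2.1
  have h5 : 1.99 * ((n : ℝ) * Real.log n) ≤ highTime n := by linarith
  have h6 : 0.99 * (n : ℝ) ≤ n - (1 : ℕ) := by push_cast; linarith
  calc 3.9 * Real.log n * (n.choose 2 : ℕ) ≤ 3.9 * Real.log n * ((n : ℝ) ^ 2 / 2) := by
        gcongr
        exact choose_le n
    _ ≤ 1.99 * ((n : ℝ) * Real.log n) * (0.99 * n) := by
        nlinarith [mul_pos (by linarith : 0 < Real.log n) (pow_pos h.pos 2)]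
    _ ≤ _ := by gcongr

/-- About `0.4 n log n` of the `n ^ 2 / 2` positions are blue, so two vertices together expect `1.6
log n` blue edges. It matters that `7 / 8` of the bound `1.5` exceeds `1`. -/
theorem le_lowTime_sub_redTime_div (h : IsLarge n) :
    1.5 * Real.log n ≤
      ((lowTime n - redTime n : ℕ) : ℝ) / (n.choose 2 : ℕ) * (2 * (n - 3) : ℕ) := by
  rw [div_mul_eq_mul_div, le_div_iff₀ h.choose_pos, Nat.cast_sub h.redTime_le_lowTime,
    Nat.cast_mul, Nat.cast_sub (by have := h.three_le; omega)]
  have h1 := lowTime_gt n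
  have h1' := h.redTime_le
  have h2 := h.le_mul_log
  have h3 := h.1
  have hl := h.2.1
  have h5 : 0.399 * ((n : ℝ) * Real.log n) ≤ lowTime n - redTime n := by linarith
  have h7 : (0 : ℝ) ≤ lowTime n - redTime n := by linarith
  have h6 : 1.99 * (n : ℝ) ≤ (2 : ℕ) * (n - (3 : ℕ)) := by push_cast; linarith
  calc 1.5 * Real.log n * (n.choose 2 : ℕ) ≤ 1.5 * Real.log n * ((n : ℝ) ^ 2 / 2) := by
        gcongr
        exact choose_le n
    _ ≤ 0.399 * ((n : ℝ) * Real.log n) * (1.99 * n) := by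
        nlinarith [mul_pos (by linarith : 0 < Real.log n) (pow_pos h.pos 2)]
    _ ≤ _ := by gcongr

theorem le_redTime_div (h : IsLarge n) :
    0.09 * Real.log n / n ≤ (redTime n : ℝ) / (n.choose 2 : ℕ) := by
  rw [div_le_div_iff₀ h.pos h.choose_pos]
  have h1 := redTime_gt n
  have h2 := h.le_mul_log
  have hl := h.2.1
  have h5 : 0.045 * ((n : ℝ) * Real.log n) ≤ redTime n := by linarith
  calc 0.09 * Real.log n * (n.choose 2 : ℕ) ≤ 0.09 * Real.log n * ((n : ℝ) ^ 2 / 2) := by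
        gcongr
        exact choose_le n
    _ = 0.045 * ((n : ℝ) * Real.log n) * n := by ring
    _ ≤ _ := by have := h.pos; gcongr

end IsLarge

theorem tendsto_exp_neg_mul_log {c : ℝ} (hc : 0 < c) :
    Tendsto (fun n : ℕ => Real.exp (-(c * Real.log n))) atTop (𝓝 0) :=
  Real.tendsto_exp_neg_atTop_nhds_zero.comp (tendsto_log_natCast.const_mul_atTop hc)

open Classical in
-- The expected degree is about `4 log n`, so the lower tail with rate `1 / 2` gives at most a
-- constant times `n ^ (-1.95)` per vertex, which beats the `n` choices.
theorem tendsto_prob_exists_degree_lt (k : ℕ) :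
    Tendsto (fun n : ℕ => orderingProb {π : EdgeOrdering n |
      ∃ v, (Finset.univ.filter ((graphProcess π (highTime n)).Adj v)).card < 2 * k})
      atTop (𝓝 0) := by
  have hlim : Tendsto (fun n : ℕ => (2 : ℝ) ^ (2 * k) * Real.exp (-(0.9 * Real.log n))) atTop
      (𝓝 0) := by
    simpa using (tendsto_exp_neg_mul_log (c := 0.9) (by norm_num)).const_mul ((2 : ℝ) ^ (2 * k))
  refine squeeze_zero' (.of_forall fun n => orderingProb_nonneg _) ?_ hlim
  filter_upwards [eventually_isLarge] with n h
  have h1 := h.highTime_add_lt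
  refine (prob_exists_degree_lt_le (by omega) (by omega)).trans ?_
  have h2 := h.le_highTime_div
  have hl := h.2.1
  calc (n : ℝ) * (2 ^ (2 * k) * Real.exp (-(1 / 2 * ((highTime n : ℝ) / (n.choose 2 : ℕ)) *
          (n - 1 : ℕ))))
      ≤ Real.exp (Real.log n) * (2 ^ (2 * k) * Real.exp (-(1.95 * Real.log n))) := by
        rw [Real.exp_log h.pos]
        gcongr _ * (_ * Real.exp ?_)
        linarith
    _ = 2 ^ (2 * k) * Real.exp (Real.log n + -(1.95 * Real.log n)) := by rw [Real.exp_add]; ring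
    _ ≤ _ := by
        gcongr
        linarith

/-- The time is `9 / 10` of the threshold `n log n / 2`, so the expected number of isolated vertices
grows like a power of `n`; the lower bound used is `n ^ 0.05`. -/
theorem tendsto_prob_no_isolated :
    Tendsto (fun n : ℕ => orderingProb {π : EdgeOrdering n |
      ∀ v, ∃ u, (graphProcess π (lowTime n)).Adj v u}) atTop (𝓝 0) := by
  have hlim : Tendsto (fun n : ℕ => Real.exp (-(0.05 * Real.log n)) + 0.95 * (Real.log n / n))
      atTop (𝓝 0) := by
    simpa using (tendsto_exp_neg_mul_log (c := 0.05) (by norm_num)).add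
      (tendsto_log_div_natCast.const_mul 0.95)
  refine squeeze_zero' (.of_forall fun n => orderingProb_nonneg _) ?_ hlim
  filter_upwards [eventually_isLarge] with n h
  have h1 := h.lowTime_add_lt
  have h3 := h.three_le
  refine (prob_no_isolated_le (by omega) h1 rfl).trans ?_
  set N : ℝ := ((n.choose 2 : ℕ) : ℝ) with hN
  set t : ℝ := (lowTime n : ℝ) with ht
  have hn2 : ((n - 2 : ℕ) : ℝ) = n - 2 := by
    rw [Nat.cast_sub (by omega)]
    norm_num
  have htN : ((n.choose 2 - lowTime n : ℕ) : ℝ) = N - t := by rw [Nat.cast_sub (by omega)]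
  rw [htN, hn2]
  set g := (N - t - (n - 2)) / (N - (n - 2)) with hg
  have ht0 : 0 ≤ t := by positivity
  have hl := h.2.1
  have hn0 := h.pos
  have h4 := h.lowTime_le
  have h5 := h.mul_log_le
  have h6 := h.le_choose
  have h7 := h.mul_le_sq
  have h8 : 0.498 * (n : ℝ) ^ 2 ≤ N - t - (n - 2) := by linarith
  have hsq : 0 < (n : ℝ) ^ 2 := pow_pos h.pos 2
  have hden : 0 < N - t - (n - 2) := by linarith
  have hden' : 0 < N - (n - 2) := by linarith
  have hg0 : 0 < g := div_pos hden hden'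
  have hg1 : 1 / g - 1 = t / (N - t - (n - 2)) := by
    rw [hg, one_div_div, div_sub_one hden.ne']
    congr 1
    ring
  have hg2 : 1 / g - 1 ≤ 0.95 * (Real.log n / n) := by
    rw [hg1, ← mul_div_assoc, div_le_div_iff₀ hden hn0]
    calc t * n ≤ 9 * ((n : ℝ) * Real.log n) / 20 * n := by gcongr
      _ ≤ 0.95 * Real.log n * (0.498 * (n : ℝ) ^ 2) := by
          nlinarith [mul_pos (by linarith : 0 < Real.log n) hsq]
      _ ≤ _ := by gcongr
  refine add_le_add ?_ hg2
  -- From `log g ≥ 1 - 1 / g`; hence `g ^ n ≥ n ^ (-0.95)`.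
  have hlog : -(0.95 * (Real.log n / n)) ≤ Real.log g := by
    have := Real.one_sub_inv_le_log_of_pos hg0
    rw [← one_div] at this
    linarith
  have h9 : Real.exp (0.05 * Real.log n) ≤ n * g ^ n := by
    calc Real.exp (0.05 * Real.log n)
        = Real.exp (Real.log n) * Real.exp (n * -(0.95 * (Real.log n / n))) := by
          rw [← Real.exp_add]
          congr 1
          field_simp
          ring
      _ ≤ n * g ^ n := by
          rw [Real.exp_log hn0, Real.exp_nat_mul]
          gcongr
          rwa [← Real.le_log_iff_exp_le hg0]
  rw [Real.exp_neg, ← one_div]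
  exact one_div_le_one_div_of_le (Real.exp_pos _) h9

theorem smallSetDensity_mul_le {k n : ℕ} (hk : 1 ≤ k) (hn : 1 ≤ Real.log n) :
    (smallSetDensity k n : ℝ) * k ≤ Real.log n / 1000 := by
  have hk' : (1 : ℝ) ≤ k := by exact_mod_cast hk
  calc (smallSetDensity k n : ℝ) * k ≤ Real.log n / (1000 * k) * k := by
        gcongr
        exact Nat.floor_le (by positivity)
    _ = Real.log n / 1000 := by field_simp

open Classical in
-- Two given vertices are both small with probability at most a constant times `n ^ (-1.25)`. Each
-- prescribed edge costs a factor of order `log n / n`, so both union bounds are `n ^ (-0.25)` up to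
-- powers of `log n`.
theorem tendsto_prob_small_close {k : ℕ} (hk : 1 ≤ k) :
    Tendsto (fun n : ℕ => orderingProb {π : EdgeOrdering n | ∃ u v, u ≠ v ∧
      u ∈ smallVertices π (redTime n) (lowTime n) (4 * reservedPairs k n) ∧
      v ∈ smallVertices π (redTime n) (lowTime n) (4 * reservedPairs k n) ∧
      ((graphProcess π (highTime n)).Adj u v ∨ ∃ w, (graphProcess π (highTime n)).Adj u w ∧
        (graphProcess π (highTime n)).Adj v w)}) atTop (𝓝 0) := by
  have hlim : Tendsto (fun n : ℕ => Real.exp 17 * (20 * ((0.25 * Real.log n) ^ 1 *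
      Real.exp (-(0.25 * Real.log n))) + 400 * ((0.25 * Real.log n) ^ 2 *
      Real.exp (-(0.25 * Real.log n))))) atTop (𝓝 0) := by
    have hx : Tendsto (fun n : ℕ => 0.25 * Real.log n) atTop atTop :=
      tendsto_log_natCast.const_mul_atTop (by norm_num)
    have h1 := (Real.tendsto_pow_mul_exp_neg_atTop_nhds_zero 1).comp hx
    have h2 := (Real.tendsto_pow_mul_exp_neg_atTop_nhds_zero 2).comp hx
    have h3 := ((h1.const_mul 20).add (h2.const_mul 400)).const_mul (Real.exp 17)
    simp only [mul_zero, add_zero] at h3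
    exact h3
  refine squeeze_zero' (.of_forall fun n => orderingProb_nonneg _) ?_ hlim
  filter_upwards [eventually_isLarge] with n h
  have h1 := h.highTime_add_lt
  have h2 := h.lowTime_add_lt
  have h3 := h.three_le
  have hl := h.2.1
  have hn0 := h.pos
  have hN := h.choose_pos
  -- The factor `8 ^ (2 d)` is at most `exp (2.1 (0.016 log n + 8))`. The exponent is thus at most
  -- `16.8 + (0.0336 - 1.3125) log n`. The constant `1000` in `smallSetDensity` makes the first
  -- coefficient this small.
  have hy : (8 : ℝ) ^ (2 * (4 * reservedPairs k n)) * Real.exp (-(7 / 8 *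
      (((lowTime n - redTime n : ℕ) : ℝ) / (n.choose 2 : ℕ)) * (2 * (n - 3) : ℕ))) ≤
      Real.exp (17 - 1.25 * Real.log n) := by
    have h8 : (8 : ℝ) ≤ Real.exp 2.1 := by
      have : Real.log 8 ≤ 2.1 := by
        rw [show (8 : ℝ) = 2 ^ 3 by norm_num, Real.log_pow]
        have := Real.log_two_lt_d9
        push_cast
        linarith
      rwa [Real.log_le_iff_le_exp (by norm_num)] at this
    have h9 : ((2 * (4 * reservedPairs k n) : ℕ) : ℝ) ≤ 0.016 * Real.log n + 8 := by
      have := smallSetDensity_mul_le hk hl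
      rw [reservedPairs]
      push_cast
      linarith
    have h10 := h.le_lowTime_sub_redTime_div
    calc (8 : ℝ) ^ (2 * (4 * reservedPairs k n)) * Real.exp (-(7 / 8 *
          (((lowTime n - redTime n : ℕ) : ℝ) / (n.choose 2 : ℕ)) * (2 * (n - 3) : ℕ)))
        ≤ Real.exp 2.1 ^ (2 * (4 * reservedPairs k n)) *
          Real.exp (-(7 / 8 * (1.5 * Real.log n))) := by
          gcongr ?_ ^ _ * Real.exp ?_
          linarith
      _ = Real.exp (((2 * (4 * reservedPairs k n) : ℕ) : ℝ) * 2.1 +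
          -(7 / 8 * (1.5 * Real.log n))) := by rw [← Real.exp_nat_mul, ← Real.exp_add]
      _ ≤ _ := by
          gcongr
          linarith
  have hpos : (0 : ℝ) ≤ (highTime n : ℝ) / ((n.choose 2 : ℕ) - 2 * n) := by
    have : (highTime n : ℝ) + 2 * n < (n.choose 2 : ℕ) := by exact_mod_cast h1
    have h0 : (0 : ℝ) ≤ highTime n := by positivity
    exact div_nonneg h0 (by linarith)
  refine (prob_small_close_le (by omega) (by omega) (by omega) hy hpos
    h.highTime_div_sub_le).trans (le_of_eq ?_)
  have hexp : Real.exp (17 - 1.25 * Real.log n) =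
      Real.exp 17 * Real.exp (-(0.25 * Real.log n)) / n := by
    rw [eq_div_iff hn0.ne']
    conv_lhs => rw [← Real.exp_log hn0, Real.log_exp]
    rw [← Real.exp_add, ← Real.exp_add]
    congr 1
    ring
  rw [hexp]
  field_simp
  ring

/-- With base `θ = exp (8000 k)` and `b ≥ log n / (2000 k)` one has `θ ^ b ≥ n ^ 4`. The restriction
to sets of size `n / (3 θ)` keeps the exponential moment below `n` per vertex of `T`. So `y = n ^
(-2)` works and the bound is `(1 + n ^ (-2)) ^ n - 1`. -/
theorem tendsto_prob_exists_dense {k : ℕ} (hk : 1 ≤ k) :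
    Tendsto (fun n : ℕ => orderingProb {π : EdgeOrdering n | ∃ T : Finset (Fin n), T.Nonempty ∧
      T.card ≤ smallSetSize k n ∧ smallSetDensity k n * T.card ≤
        ((pairsIn T).filter fun e => π e ∈ positions _ 0 (highTime n)).card}) atTop (𝓝 0) := by
  have hlim : Tendsto (fun n : ℕ => Real.exp (Real.exp (-(1 * Real.log n))) - 1) atTop (𝓝 0) := by
    have h1 := (Real.continuous_exp.tendsto 0).comp (tendsto_exp_neg_mul_log (c := 1) one_pos)
    have h2 := h1.sub_const 1
    simpa using h2
  refine squeeze_zero' (.of_forall fun n => orderingProb_nonneg _) ?_ hlim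
  filter_upwards [eventually_isLarge, tendsto_log_natCast.eventually_ge_atTop (2000 * k)]
    with n h hlk
  have h1 := h.highTime_add_lt
  have hl := h.2.1
  have hn0 := h.pos
  have hN := h.choose_pos
  have hk' : (1 : ℝ) ≤ k := by exact_mod_cast hk
  have hθ := one_le_momentBase k
  have hs : (smallSetSize k n : ℝ) ≤ n / (3 * momentBase k) := Nat.floor_le (by positivity)
  have hsn : (smallSetSize k n : ℝ) ≤ n / 3 := hs.trans (by gcongr; linarith)
  refine (prob_exists_dense_le (θ := momentBase k) (y := Real.exp (-(2 * Real.log n)))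
    (by omega) ?_ hθ ?_).trans ?_
  · have h2 := h.le_choose
    have h3 : (smallSetSize k n : ℝ) ^ 2 ≤ (n / 3) ^ 2 := by gcongr
    have h4 : 0 < (n : ℝ) ^ 2 := pow_pos hn0 2
    have : (smallSetSize k n : ℝ) ^ 2 < 2 * (n.choose 2 : ℕ) := by linarith
    exact_mod_cast this
  · have hb : Real.log n / (2000 * k) ≤ smallSetDensity k n := by
      have h2 := Nat.sub_one_lt_floor (Real.log n / (1000 * k))
      rw [← smallSetDensity] at h2
      have h3 : 1 ≤ Real.log n / (2000 * k) := by rwa [one_le_div (by positivity)]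
      have h4 : Real.log n / (1000 * k) = 2 * (Real.log n / (2000 * k)) := by field_simp; norm_num
      linarith
    rw [momentBase, ← Real.exp_nat_mul, ← Real.exp_add, ← momentBase]
    gcongr
    have h5 : momentBase k * ((highTime n : ℝ) / (n.choose 2 : ℕ)) * smallSetSize k n / 2 ≤
        momentBase k * (4.1 * Real.log n / n) * (n / (3 * momentBase k)) / 2 := by
      have := h.highTime_div_le
      generalize (highTime n : ℝ) / (n.choose 2 : ℕ) = p at this ⊢
      gcongr
    have h6 : momentBase k * (4.1 * Real.log n / n) * (n / (3 * momentBase k)) / 2 =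
        4.1 / 6 * Real.log n := by
      field_simp
      norm_num
    have h7 : 4 * Real.log n ≤ smallSetDensity k n * (8000 * k) := by
      calc 4 * Real.log n = Real.log n / (2000 * k) * (8000 * k) := by field_simp; norm_num
        _ ≤ _ := by gcongr
    linarith
  · gcongr
    have h2 : 1 + Real.exp (-(2 * Real.log n)) ≤ Real.exp (Real.exp (-(2 * Real.log n))) := by
      linarith [Real.add_one_le_exp (Real.exp (-(2 * Real.log n)))]
    refine (pow_le_pow_left₀ (by positivity) h2 n).trans (le_of_eq ?_)
    rw [← Real.exp_nat_mul]
    congr 1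
    conv_lhs => rw [← Real.exp_log hn0, Real.log_exp]
    rw [← Real.exp_add]
    congr 1
    ring

/-- The sets have linear size, so a cut expects a constant multiple of `n log n` red edges. This
beats both the `4 ^ n` choices of the cut and the factor `2 ^ m` with `m` linear in `n`. -/
theorem tendsto_prob_exists_sparse_cut (k : ℕ) :
    Tendsto (fun n : ℕ => orderingProb {π : EdgeOrdering n | ∃ A B : Finset (Fin n),
      Disjoint A B ∧ smallSetSize k n + 1 - k ≤ A.card ∧ smallSetSize k n + 1 - k ≤ B.card ∧
      ((pairsBetween A B).filter fun e => π e ∈ positions _ 0 (redTime n)).card ≤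
        2 * (k + 1) * n + 2}) atTop (𝓝 0) := by
  have hlim := tendsto_exp_neg_mul_log (c := 1) one_pos
  have hθ := one_le_momentBase k
  refine squeeze_zero' (.of_forall fun n => orderingProb_nonneg _) ?_ hlim
  filter_upwards [eventually_isLarge, tendsto_log_natCast.eventually_ge_atTop
    ((2 * k + 7) * (16 * momentBase k ^ 2) / 0.045),
    (tendsto_natCast_atTop_atTop (R := ℝ)).eventually_ge_atTop (12 * momentBase k * k)]
    with n h hlk hnk
  have h1 := h.lowTime_add_lt
  have h1' := h.redTime_le_lowTime
  have hl := h.2.1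
  have hn0 := h.pos
  have hn1 := h.1
  have hN := h.choose_pos
  have hs : (n : ℝ) / (4 * momentBase k) ≤ (smallSetSize k n + 1 - k : ℕ) := by
    have h2 := Nat.lt_floor_add_one ((n : ℝ) / (3 * momentBase k))
    rw [← smallSetSize] at h2
    have h3 : ((smallSetSize k n + 1 : ℕ) : ℝ) - k ≤ (smallSetSize k n + 1 - k : ℕ) := by
      rw [sub_le_iff_le_add]
      exact_mod_cast (by omega : smallSetSize k n + 1 ≤ smallSetSize k n + 1 - k + k)
    push_cast at h3
    have h4 : (k : ℝ) ≤ n / (12 * momentBase k) := by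
      rw [le_div_iff₀ (by positivity)]
      linarith
    have h5 : (n : ℝ) / (3 * momentBase k) = n / (4 * momentBase k) + n / (12 * momentBase k) := by
      field_simp
      norm_num
    linarith
  refine (prob_exists_sparse_cut_le (by omega) ?_).trans ?_
  · have h2 := h.le_choose
    have h4 : 0 < (n : ℝ) ^ 2 := pow_pos hn0 2
    have : (n : ℝ) ^ 2 < 4 * (n.choose 2 : ℕ) := by linarith
    exact_mod_cast this
  have h2 : (2 : ℝ) ≤ Real.exp 1 := by linarith [Real.add_one_le_exp (1 : ℝ)]
  have h4 : (4 : ℝ) ≤ Real.exp 2 := by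
    have : Real.exp 2 = Real.exp 1 * Real.exp 1 := by rw [← Real.exp_add]; norm_num
    nlinarith
  -- Since `4 ≤ e ^ 2` and `2 ≤ e`, the other factors contribute at most `(2 k + 4) n + 2` to the
  -- exponent; the surplus of `3 n` leaves room for `log n`.
  have h5 : (2 * k + 7) * (n : ℝ) ≤ 1 / 2 * (0.09 * Real.log n / n) *
      (n / (4 * momentBase k)) ^ 2 := by
    have : 1 / 2 * (0.09 * Real.log n / n) * (n / (4 * momentBase k)) ^ 2 =
        (Real.log n * 0.045 / (16 * momentBase k ^ 2)) * n := by
      field_simp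
      norm_num
    rw [this]
    gcongr
    rw [le_div_iff₀ (by positivity)]
    rw [div_le_iff₀ (by norm_num)] at hlk
    exact hlk
  calc (4 : ℝ) ^ n * (2 ^ (2 * (k + 1) * n + 2) * Real.exp (-(1 / 2 *
        ((redTime n : ℝ) / (n.choose 2 : ℕ)) * (smallSetSize k n + 1 - k : ℕ) ^ 2)))
      ≤ Real.exp 2 ^ n * (Real.exp 1 ^ (2 * (k + 1) * n + 2) * Real.exp (-(1 / 2 *
        (0.09 * Real.log n / n) * (n / (4 * momentBase k)) ^ 2))) := by
        have h6 := h.le_redTime_div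
        have h7 : 0 ≤ (redTime n : ℝ) / (n.choose 2 : ℕ) := by positivity
        generalize (redTime n : ℝ) / (n.choose 2 : ℕ) = p at h6 h7 ⊢
        gcongr
    _ ≤ Real.exp 2 ^ n * (Real.exp 1 ^ (2 * (k + 1) * n + 2) *
        Real.exp (-((2 * k + 7) * (n : ℝ)))) := by gcongr
    _ = Real.exp (n * 2 + (((2 * (k + 1) * n + 2 : ℕ) : ℝ) * 1 + -((2 * k + 7) * (n : ℝ)))) := by
        rw [← Real.exp_nat_mul, ← Real.exp_nat_mul, ← Real.exp_add, ← Real.exp_add]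
    _ ≤ Real.exp (-(1 * Real.log n)) := by
        gcongr
        push_cast
        have := h.2.2
        linarith

end Asymptotics

theorem mainTheorem3 (k : ℕ) (hk : 1 ≤ k) :
    Tendsto
      (fun n : ℕ => processProb {π : EdgeOrdering n |
        hittingTime π (MakerBreaker.MakerWinsGame (IsVertexConnected k)) =
            hittingTime π (HasMinDegreeAtLeast (2 * k)) ∧
          hittingTime π (HasMinDegreeAtLeast (2 * k)) ≠ ⊤})
      atTop (𝓝 1) := by
  -- The five bad events have vanishing probability, and outside their union the deterministic lemma
  -- applies. `processProb` agrees by definition with `orderingProb` on pairs.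
  have hlim := ((((tendsto_prob_no_isolated.add (tendsto_prob_exists_degree_lt k)).add
    (tendsto_prob_small_close hk)).add (tendsto_prob_exists_dense hk)).add
    (tendsto_prob_exists_sparse_cut k)).const_sub 1
  simp only [add_zero, sub_zero] at hlim
  refine tendsto_of_tendsto_of_tendsto_of_le_of_le' hlim tendsto_const_nhds ?_
    (.of_forall fun n => orderingProb_le_one _)
  filter_upwards [eventually_isLarge, eventually_gt_atTop k] with n h hkn
  set A₁ := {π : EdgeOrdering n | ∀ v, ∃ u, (graphProcess π (lowTime n)).Adj v u}
  set A₂ := {π : EdgeOrdering n | ∃ v, (@Finset.filter _ ((graphProcess π (highTime n)).Adj v)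
    (fun _ => Classical.propDecidable _) Finset.univ).card < 2 * k}
  set A₃ := {π : EdgeOrdering n | ∃ u v, u ≠ v ∧
      u ∈ smallVertices π (redTime n) (lowTime n) (4 * reservedPairs k n) ∧
      v ∈ smallVertices π (redTime n) (lowTime n) (4 * reservedPairs k n) ∧
      ((graphProcess π (highTime n)).Adj u v ∨ ∃ w, (graphProcess π (highTime n)).Adj u w ∧
        (graphProcess π (highTime n)).Adj v w)}
  set A₄ := {π : EdgeOrdering n | ∃ T : Finset (Fin n), T.Nonempty ∧
      T.card ≤ smallSetSize k n ∧ smallSetDensity k n * T.card ≤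
        ((pairsIn T).filter fun e => π e ∈ positions _ 0 (highTime n)).card}
  set A₅ := {π : EdgeOrdering n | ∃ A B : Finset (Fin n),
      Disjoint A B ∧ smallSetSize k n + 1 - k ≤ A.card ∧ smallSetSize k n + 1 - k ≤ B.card ∧
      ((pairsBetween A B).filter fun e => π e ∈ positions _ 0 (redTime n)).card ≤
        2 * (k + 1) * n + 2}
  have hsum : orderingProb (A₁ ∪ A₂ ∪ A₃ ∪ A₄ ∪ A₅) ≤ orderingProb A₁ + orderingProb A₂ +
      orderingProb A₃ + orderingProb A₄ + orderingProb A₅ := by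
    have h1 := orderingProb_union_le A₁ A₂
    have h2 := orderingProb_union_le (A₁ ∪ A₂) A₃
    have h3 := orderingProb_union_le (A₁ ∪ A₂ ∪ A₃) A₄
    have h4 := orderingProb_union_le (A₁ ∪ A₂ ∪ A₃ ∪ A₄) A₅
    linarith
  have hcompl := one_sub_le_orderingProb_compl (A₁ ∪ A₂ ∪ A₃ ∪ A₄ ∪ A₅)
  refine le_trans (le_trans (sub_le_sub_left hsum 1) hcompl) (orderingProb_mono ?_)
  intro π hπ
  simp only [Set.mem_compl_iff, Set.mem_union, not_or] at hπ
  obtain ⟨⟨⟨⟨h1, h2⟩, h3⟩, h4⟩, h5⟩ := hπ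
  have ht := h.highTime_add_lt
  refine hittingTime_eq_of_pseudorandom (b := smallSetDensity k n) (D := reservedPairs k n)
    (s := smallSetSize k n) (r := redTime n) (t₀ := lowTime n) (t₁ := highTime n) hk hkn
    h.redTime_le_lowTime (by omega) ?_ ?_ ?_ ?_ ?_ le_rfl ?_
  · by_contra! hcon
    exact h1 hcon
  · intro v
    by_contra! hcon
    exact h2 ⟨v, hcon⟩
  · exact fun u hu v hv huv hadj => h3 ⟨u, v, huv, hu, hv, .inl hadj⟩
  · exact fun u hu v hv huv w hw hw' => h3 ⟨u, v, huv, hu, hv, .inr ⟨w, hw, hw'⟩⟩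
  · intro T hT hTs
    by_contra! hcon
    refine h4 ⟨T, hT, hTs, ?_⟩
    have h6 := card_filter_adj_le π (positions _ 0 (highTime n)) T
    rw [← graphProcess_eq] at h6
    have h7 := hcon.trans h6
    rw [mul_assoc] at h7
    convert Nat.le_of_mul_le_mul_left h7 two_pos
  · intro A A' hd hA hA'
    by_contra! hcon
    refine h5 ⟨A, A', hd, by omega, by omega, ?_⟩
    have h6 := card_filter_pairsBetween_position hd π (positions _ 0 (redTime n))
    rw [← graphProcess_eq] at h6
    refine le_trans (le_of_eq ?_) hcon.le
    convert h6
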